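/- Let $k\ge 2$ be an integer and $c>0$, both fixed. A coloring of $[n]=\{1,\dots,n\}$ is a map $x:[n]\to\{c_1,\dots,c_k\}$, where $c_1,\dots,c_k$ are $k$ fixed distinct colors. Write $\mathbf K(x)$ for the $n\times n$ matrix with entries $\mathbf K_{ij}(x)=1$ if $x(i)\ne x(j)$ and $\mathbf K_{ij}(x)=0$ if $x(i)=x(j)$. For each $n$ (all large $n$, or all $n$ in a sequence tending to infinity), let $n_1\ge n_2\ge\dots\ge n_k$ be integers (depending on $n$) with $n_k\ge cn$, let $y$ be a coloring of $[n]$ in which color $c_i$ is used exactly $n_i$ times for every $i$, let $\sigma=\sigma_n\in\mathbb R$ be deterministic, and let $\mathbf W$ be a random $n\times n$ matrix with i.i.d. standard Gaussian entries. Observe $$\mathbf R=\mathbf K(y)+\sigma\mathbf W .$$ Let $\Omega_{2c/3}$ be the set of colorings of $[n]$ in which every color is used at least $2cn/3$ times, and let $\Omega_{n_1,\dots,n_k}$ be the set of colorings in which color $c_i$ is used exactly $n_i$ times for every $i$. Let $$\tilde y\in\operatorname*{argmin}_{x\in\Omega_{2c/3}}\|\mathbf R-\mathbf K(x)\|_F^2,\qquad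 \overline y\in\operatorname*{argmin}_{x\in\Omega_{n_1,\dots,n_k}}\|\mathbf R-\mathbf K(x)\|_F^2$$ be arbitrary choices of minimizers, where $\|\cdot\|_F$ is the Frobenius norm. Let $C(y)$ be the set of colorings $x$ that induce the same partition as $y$, i.e. $x(i)=x(j)\iff y(i)=y(j)$ for all $i,j\in[n]$. 1. If there is a constant $\delta>0$ independent of $n$ such that $\sigma^2<\dfrac{(1-\delta)(n_k+n_{k-1})}{4\log n}$ for all large $n$, then $\lim_{n\to\infty}\Pr(\tilde y\in C(y))=1$ and $\lim_{n\to\infty}\Pr(\overline y\in C(y))=1$. 2. If there is a constant $\delta>0$ independent of $n$ such that $\sigma^2>\dfrac{(1+\delta)(n_k+n_{k-1})}{4\log n}$ for all large $n$, then $\lim_{n\to\infty}\Pr(\tilde y\in C(y))=0$ and $\lim_{n\to\infty}\Pr(\overline y\in C(y))=0$. -/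

import Mathlib

open MeasureTheory ProbabilityTheory Filter Topology

namespace ColorRecovery

/-- A color assignment mapping of the `n` vertices with `k` distinct colors; the color `c_{j+1}` is
represented by its index `j : Fin k`. -/
abbrev Coloring (n k : ℕ) : Type := Fin n → Fin k

/-- The number of vertices that have color `j` under `x`. -/
def classSize {n k : ℕ} (x : Coloring n k) (j : Fin k) : ℕ :=
  (Finset.univ.filter fun i => x i = j).card

/-- The colorings with the prescribed class sizes `s 0, …, s (k - 1)`. -/
def fixedSizes (n : ℕ) {k : ℕ} (s : Fin k → ℕ) : Set (Coloring n k) :=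
  {x | ∀ j, classSize x j = s j}

/-- The colorings in which every color is used on at least `a * n` vertices. -/
def minSize (n k : ℕ) (a : ℝ) : Set (Coloring n k) :=
  {x | ∀ j, a * n ≤ (classSize x j : ℝ)}

/-- The matrix with entry `1` where the two vertices have different colors and `0` elsewhere. -/
def kMatrix {n k : ℕ} (x : Coloring n k) : Matrix (Fin n) (Fin n) ℝ :=
  Matrix.of fun i j => if x i ≠ x j then 1 else 0

/-- `x` and `y` are equal up to relabeling of the colors: they induce the same partition. -/
def SamePartition {n k : ℕ} (x y : Coloring n k) : Prop :=
  ∀ i j, x i = x j ↔ y i = y j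

/-- The Frobenius norm of a real matrix. -/
noncomputable def frobeniusNorm {n : ℕ} (A : Matrix (Fin n) (Fin n) ℝ) : ℝ :=
  letI := Matrix.frobeniusNormedAddCommGroup (m := Fin n) (n := Fin n) (α := ℝ)
  ‖A‖

/-- The observation `K(y) + σ W`. -/
def observation {n k : ℕ} (y : Coloring n k) (σ : ℝ) (W : Matrix (Fin n) (Fin n) ℝ) :
    Matrix (Fin n) (Fin n) ℝ :=
  kMatrix y + σ • W

/-- `x` is a maximum likelihood estimate over the sample space `S` for the observed matrix `R`:
it belongs to `S` and minimizes `‖R - K(·)‖_F ^ 2` over `S`. -/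
def IsMLE {n k : ℕ} (S : Set (Coloring n k)) (R : Matrix (Fin n) (Fin n) ℝ)
    (x : Coloring n k) : Prop :=
  x ∈ S ∧ IsMinOn (fun z => frobeniusNorm (R - kMatrix z) ^ 2) S x

/-- `W` is a random `n × n` matrix with i.i.d. standard Gaussian entries. -/
structure IsGaussianNoise {n : ℕ} {Ω : Type*} [MeasurableSpace Ω] (P : Measure Ω)
    (W : Ω → Matrix (Fin n) (Fin n) ℝ) : Prop where
  hasLaw : ∀ i j, HasLaw (fun ω => W ω i j) (gaussianReal 0 1) P
  indep : iIndepFun (fun (p : Fin n × Fin n) ω => W ω p.1 p.2) P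

end ColorRecovery

namespace ColorRecovery

/-! Write `D = sqDist x y`, `S = n_k + n_{k-1}` and `L = log n`. The objective at `x` minus the
objective at the truth is `D - 2σ⟨K(x) - K(y), W⟩`, a Gaussian with mean `D` and variance `4σ²D`. So
`x` ties or beats `y` with probability at most `exp(-D/(8σ²))`.

Recovery is a union bound. A coloring that misplaces `h` vertices, `h` small against `n`, has `D` at
least about `2hS` (`le_sqDist_of_errors`), so below the threshold its probability is at most
`n^{-(1+δ/2)h}`. This is summable against the number of such colorings (`sum_ne_pow_errors_le`). If
`D ≤ γn²`, a relabeling of the colors makes the number of errors small (`exists_perm_errors_le`). If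
`D > γn²`, the bound `exp(-γnL/2)` absorbs all `k^n` colorings.

Failure comes from swapping a vertex `i` of one of the two smallest classes with a vertex `j` of the
other, which keeps all class sizes and has `D ≤ 4S`. With `i` and `j` restricted to sets of `h =
⌊εcn⌋` vertices, the noise of the swap splits into a term for `i`, a term for `j` and a small
remainder. Each of the two families of terms is independent with variance at least `2(S - 2h)`, so
its maximum is close to `2√(SL)`. Above the threshold `S/σ < 2√(SL)/√(1+δ)`, so some swap strictly
beats `y` with high probability (`measure_forall_swap_ge_le_noSwapError`). -/

/-- The Frobenius inner product of two real matrices. -/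
def frobInner {n : ℕ} (A B : Matrix (Fin n) (Fin n) ℝ) : ℝ :=
  ∑ p : Fin n × Fin n, A p.1 p.2 * B p.1 p.2

lemma frobInner_self_nonneg {n : ℕ} (A : Matrix (Fin n) (Fin n) ℝ) : 0 ≤ frobInner A A :=
  Finset.sum_nonneg fun _ _ => mul_self_nonneg _

/-! ### Gaussian linear functionals of the noise -/

section Noise

variable {n : ℕ} {Ω : Type*} [MeasurableSpace Ω] {P : Measure Ω}
  {W : Ω → Matrix (Fin n) (Fin n) ℝ}

lemma IsGaussianNoise.hasGaussianLaw (hW : IsGaussianNoise P W) :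
    HasGaussianLaw (fun ω (p : Fin n × Fin n) => W ω p.1 p.2) P :=
  iIndepFun.hasGaussianLaw (fun p => ⟨by rw [(hW.hasLaw p.1 p.2).map_eq]; infer_instance⟩)
    hW.indep

lemma IsGaussianNoise.memLp_two (hW : IsGaussianNoise P W) (p : Fin n × Fin n) :
    MemLp (fun ω => W ω p.1 p.2) 2 P :=
  (hW.hasGaussianLaw.eval p).memLp_two

lemma IsGaussianNoise.integral_entry (hW : IsGaussianNoise P W) (p : Fin n × Fin n) :
    ∫ ω, W ω p.1 p.2 ∂P = 0 := by
  rw [(hW.hasLaw p.1 p.2).integral_eq]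
  exact integral_id_gaussianReal

lemma IsGaussianNoise.covariance_entry (hW : IsGaussianNoise P W) (p q : Fin n × Fin n) :
    cov[fun ω => W ω p.1 p.2, fun ω => W ω q.1 q.2; P] = if p = q then 1 else 0 := by
  have := hW.hasGaussianLaw.isProbabilityMeasure
  split_ifs with h
  · subst h
    rw [covariance_self (hW.memLp_two p).aestronglyMeasurable.aemeasurable,
      (hW.hasLaw p.1 p.2).variance_eq]
    simp
  · exact (hW.indep.indepFun h).covariance_eq_zero (hW.memLp_two p) (hW.memLp_two q)

lemma IsGaussianNoise.covariance_frobInner (hW : IsGaussianNoise P W)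
    (A B : Matrix (Fin n) (Fin n) ℝ) :
    cov[fun ω => frobInner A (W ω), fun ω => frobInner B (W ω); P] = frobInner A B := by
  have := hW.hasGaussianLaw.isProbabilityMeasure
  unfold frobInner
  rw [covariance_fun_sum_fun_sum (fun p => (hW.memLp_two p).const_mul _)
    (fun p => (hW.memLp_two p).const_mul _)]
  simp_rw [covariance_const_mul_left, covariance_const_mul_right, hW.covariance_entry]
  simp

lemma IsGaussianNoise.hasGaussianLaw_family (hW : IsGaussianNoise P W) {ι : Type*} [Fintype ι]
    (A : ι → Matrix (Fin n) (Fin n) ℝ) :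
    HasGaussianLaw (fun ω i => frobInner (A i) (W ω)) P := by
  let T : (Fin n × Fin n → ℝ) →L[ℝ] (ι → ℝ) :=
    ContinuousLinearMap.pi fun i => ∑ p, (A i p.1 p.2) • ContinuousLinearMap.proj p
  convert! hW.hasGaussianLaw.map T using 1
  ext ω i
  simp [T, frobInner]

lemma IsGaussianNoise.map_frobInner (hW : IsGaussianNoise P W)
    (A : Matrix (Fin n) (Fin n) ℝ) :
    P.map (fun ω => frobInner A (W ω)) = gaussianReal 0 (frobInner A A).toNNReal := by
  have := hW.hasGaussianLaw.isProbabilityMeasure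
  have hg := (hW.hasGaussianLaw_family fun _ : Unit => A).eval ()
  rw [hg.map_eq_gaussianReal, ← covariance_self hg.aemeasurable, hW.covariance_frobInner]
  congr 1
  unfold frobInner
  rw [integral_finsetSum _ fun p _ => ((hW.memLp_two p).integrable one_le_two).const_mul _]
  simp [integral_const_mul, hW.integral_entry]

/-- The functionals are jointly Gaussian with covariances given by the Frobenius inner product, so
orthogonality is independence. -/
lemma IsGaussianNoise.iIndepFun_frobInner (hW : IsGaussianNoise P W) {ι : Type*} [Fintype ι]
    (A : ι → Matrix (Fin n) (Fin n) ℝ) (hA : ∀ i j, i ≠ j → frobInner (A i) (A j) = 0) :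
    iIndepFun (fun i ω => frobInner (A i) (W ω)) P :=
  (hW.hasGaussianLaw_family A).iIndepFun_of_covariance_eq_zero fun i j hij => by
    rw [hW.covariance_frobInner, hA i j hij]

lemma IsGaussianNoise.neg (hW : IsGaussianNoise P W) : IsGaussianNoise P (fun ω => -W ω) where
  hasLaw i j := by
    have := gaussianReal_neg (hW.hasLaw i j)
    simp only [neg_zero] at this
    exact this
  indep := hW.indep.comp (fun _ x => -x) fun _ => measurable_neg

/-- Chernoff bound. Allowing any upper bound `v` on the variance keeps the degenerate case `v = 0`
harmless: the right side is then `1`. -/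
lemma IsGaussianNoise.measure_frobInner_ge_le (hW : IsGaussianNoise P W)
    (A : Matrix (Fin n) (Fin n) ℝ) {v t : ℝ} (ht : 0 ≤ t) (hv : frobInner A A ≤ v) :
    P {ω | t ≤ frobInner A (W ω)} ≤ ENNReal.ofReal (Real.exp (-t ^ 2 / (2 * v))) := by
  have := hW.hasGaussianLaw.isProbabilityMeasure
  have hv0 : 0 ≤ v := (frobInner_self_nonneg A).trans hv
  have hg := (hW.hasGaussianLaw_family fun _ : Unit => A).eval ()
  have hsub : HasSubgaussianMGF (fun ω => frobInner A (W ω)) v.toNNReal P := by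
    refine ⟨fun s => ?_, fun s => ?_⟩
    · have h1 := integrable_exp_mul_gaussianReal (μ := 0) (v := (frobInner A A).toNNReal) s
      rw [← hW.map_frobInner A] at h1
      exact h1.comp_aemeasurable hg.aemeasurable
    · rw [mgf_gaussianReal (hW.map_frobInner A)]
      rw [Real.coe_toNNReal _ (frobInner_self_nonneg A), Real.coe_toNNReal _ hv0]
      have := mul_le_mul_of_nonneg_right hv (sq_nonneg s)
      gcongr
      linarith
  have h2 := hsub.measure_ge_le ht
  rw [Real.coe_toNNReal _ hv0] at h2
  rw [← ENNReal.ofReal_toReal (measure_ne_top P _)]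
  exact ENNReal.ofReal_le_ofReal h2

/-- The window of width one standard deviation just above `τ√v` is disjoint from the half-line and
has mass at least `p`, by the density at its right end. Then `1 - p ≤ e^{-p}`, a form that
multiplies well over independent copies. -/
lemma gaussianReal_Iic_le {τ : ℝ} (hτ : 0 ≤ τ) {v : NNReal} (hv : v ≠ 0) {t : ℝ}
    (ht : t ≤ τ * Real.sqrt v) :
    gaussianReal 0 v (Set.Iic t) ≤
      ENNReal.ofReal (Real.exp (-(Real.exp (-(τ + 1) ^ 2 / 2) / Real.sqrt (2 * Real.pi)))) := by
  set p := Real.exp (-(τ + 1) ^ 2 / 2) / Real.sqrt (2 * Real.pi) with hp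
  have hs : 0 < Real.sqrt v := Real.sqrt_pos.2 (by positivity)
  have hss : Real.sqrt v ^ 2 = v := Real.sq_sqrt v.2
  have hlow : ENNReal.ofReal p ≤
      gaussianReal 0 v (Set.Ioc (τ * Real.sqrt v) ((τ + 1) * Real.sqrt v)) := by
    rw [gaussianReal_apply_eq_integral 0 hv]
    apply ENNReal.ofReal_le_ofReal
    have h1 : ∀ x ∈ Set.Ioc (τ * Real.sqrt v) ((τ + 1) * Real.sqrt v),
        p / Real.sqrt v ≤ gaussianPDFReal 0 v x := by
      intro x hx
      have hx0 : 0 ≤ x := (mul_nonneg hτ hs.le).trans hx.1.le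
      rw [gaussianPDFReal, hp, Real.sqrt_mul (by positivity) (v : ℝ), sub_zero, div_div,
        div_eq_inv_mul]
      refine mul_le_mul_of_nonneg_left (Real.exp_le_exp.2 ?_) (by positivity)
      rw [div_le_div_iff₀ two_pos (by positivity)]
      have : x ^ 2 ≤ (τ + 1) ^ 2 * v := by
        calc x ^ 2 ≤ ((τ + 1) * Real.sqrt v) ^ 2 := by gcongr; exact hx.2
          _ = _ := by rw [mul_pow, hss]
      linarith
    have h2 := setIntegral_mono_on (μ := volume) (integrableOn_const (by simp))
      (integrable_gaussianPDFReal 0 v).integrableOn measurableSet_Ioc h1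
    refine le_trans (le_of_eq ?_) h2
    simp only [integral_const, smul_eq_mul, measureReal_restrict_apply_univ]
    rw [Real.volume_real_Ioc_of_le (by nlinarith)]
    field_simp
    ring
  have hdisj : Disjoint (Set.Iic t) (Set.Ioc (τ * Real.sqrt v) ((τ + 1) * Real.sqrt v)) := by
    rw [Set.disjoint_left]
    intro x hx hx'
    exact absurd (hx'.1.trans_le (le_trans hx ht)) (lt_irrefl _)
  have hsum : gaussianReal 0 v (Set.Iic t) + ENNReal.ofReal p ≤ 1 := by
    refine (add_le_add_right hlow _).trans ?_
    rw [← measure_union hdisj measurableSet_Ioc]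
    exact prob_le_one
  have h3 : gaussianReal 0 v (Set.Iic t) ≤ ENNReal.ofReal (1 - p) := by
    rw [ENNReal.ofReal_sub _ (by positivity), ENNReal.ofReal_one]
    exact ENNReal.le_sub_of_add_le_right ENNReal.ofReal_ne_top hsum
  refine h3.trans (ENNReal.ofReal_le_ofReal ?_)
  have := Real.add_one_le_exp (-p)
  linarith

lemma IsGaussianNoise.measure_forall_frobInner_le (hW : IsGaussianNoise P W) {ι : Type*}
    (H : Finset ι) (A : ι → Matrix (Fin n) (Fin n) ℝ)
    (hA : ∀ i ∈ H, ∀ j ∈ H, i ≠ j → frobInner (A i) (A j) = 0)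
    {v τ t : ℝ} (hv : 0 < v) (hAv : ∀ i ∈ H, v ≤ frobInner (A i) (A i)) (hτ : 0 ≤ τ)
    (ht : t ≤ τ * Real.sqrt v) :
    P {ω | ∀ i ∈ H, frobInner (A i) (W ω) ≤ t} ≤
      ENNReal.ofReal
        (Real.exp (-(H.card * (Real.exp (-(τ + 1) ^ 2 / 2) / Real.sqrt (2 * Real.pi))))) := by
  have hind := hW.iIndepFun_frobInner (fun i : H => A i)
    (fun i j hij => hA i i.2 j j.2 (fun h => hij (Subtype.ext h)))
  have h1 := hind.measure_inter_preimage_eq_mul Finset.univ (sets := fun _ => Set.Iic t)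
    (fun _ _ => measurableSet_Iic)
  have h2 : {ω | ∀ i ∈ H, frobInner (A i) (W ω) ≤ t} =
      ⋂ i ∈ (Finset.univ : Finset H), (fun ω => frobInner (A i) (W ω)) ⁻¹' Set.Iic t := by
    ext ω; simp
  rw [h2, h1]
  have h3 : ∀ i ∈ (Finset.univ : Finset H), P ((fun ω => frobInner (A i) (W ω)) ⁻¹' Set.Iic t) ≤
      ENNReal.ofReal
        (Real.exp (-(Real.exp (-(τ + 1) ^ 2 / 2) / Real.sqrt (2 * Real.pi)))) := by
    intro i _
    have hg := (hW.hasGaussianLaw_family fun _ : Unit => A i).eval ()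
    rw [← Measure.map_apply_of_aemeasurable hg.aemeasurable measurableSet_Iic,
      hW.map_frobInner]
    have hle := hAv i i.2
    refine gaussianReal_Iic_le hτ ?_ (ht.trans ?_)
    · simpa using hv.trans_le hle
    · rw [Real.coe_toNNReal _ (frobInner_self_nonneg _)]
      gcongr
  refine (Finset.prod_le_prod' h3).trans (le_of_eq ?_)
  rw [Finset.prod_const, ← ENNReal.ofReal_pow (Real.exp_pos _).le, ← Real.exp_nat_mul]
  simp

end Noise

/-! ### The objective, and distances between colorings -/

lemma frobeniusNorm_sq {n : ℕ} (A : Matrix (Fin n) (Fin n) ℝ) :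
    frobeniusNorm A ^ 2 = frobInner A A := by
  unfold frobeniusNorm frobInner
  rw [Matrix.frobenius_norm_def, ← Real.sqrt_eq_rpow, Real.sq_sqrt (by positivity),
    Fintype.sum_prod_type]
  simp [sq]

/-- The squared Frobenius distance between the matrices of two colorings. -/
def sqDist {n k : ℕ} (x y : Coloring n k) : ℝ :=
  frobInner (kMatrix x - kMatrix y) (kMatrix x - kMatrix y)

lemma sqDist_nonneg {n k : ℕ} (x y : Coloring n k) : 0 ≤ sqDist x y :=
  frobInner_self_nonneg _

lemma objective_sub {n k : ℕ} (x y : Coloring n k) (σ : ℝ) (W : Matrix (Fin n) (Fin n) ℝ) :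
    frobeniusNorm (observation y σ W - kMatrix x) ^ 2 -
      frobeniusNorm (observation y σ W - kMatrix y) ^ 2 =
      sqDist x y - 2 * σ * frobInner (kMatrix x - kMatrix y) W := by
  rw [frobeniusNorm_sq, frobeniusNorm_sq, sqDist, frobInner, frobInner, frobInner, frobInner,
    Finset.mul_sum, ← Finset.sum_sub_distrib, ← Finset.sum_sub_distrib]
  refine Finset.sum_congr rfl fun p _ => ?_
  simp only [observation, Matrix.sub_apply, Matrix.add_apply, Matrix.smul_apply, smul_eq_mul]
  ring

lemma kMatrix_eq_iff {n k : ℕ} {x y : Coloring n k} :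
    kMatrix x = kMatrix y ↔ SamePartition x y := by
  refine ⟨fun h i j => ?_, fun h => ?_⟩
  · have := congrFun (congrFun h i) j
    simp only [kMatrix, Matrix.of_apply] at this
    split_ifs at this <;> simp_all
  · ext i j
    simp [kMatrix, h i j]

lemma kMatrix_comp {n k : ℕ} (π : Equiv.Perm (Fin k)) (x : Coloring n k) :
    kMatrix (π ∘ x) = kMatrix x :=
  kMatrix_eq_iff.2 fun i j => by simp

lemma sqDist_eq_sum {n k : ℕ} (x y : Coloring n k) :
    sqDist x y = ∑ u, ∑ v, if (x u = x v ↔ y u = y v) then (0 : ℝ) else 1 := by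
  rw [sqDist, frobInner, Fintype.sum_prod_type]
  refine Finset.sum_congr rfl fun u _ => Finset.sum_congr rfl fun v _ => ?_
  simp only [kMatrix, Matrix.sub_apply, Matrix.of_apply]
  by_cases h1 : x u = x v <;> by_cases h2 : y u = y v <;> simp [h1, h2]

/-- The number of vertices on which two colorings differ. -/
def errors {n k : ℕ} (x y : Coloring n k) : ℕ :=
  (Finset.univ.filter fun v => x v ≠ y v).card

/-- Let `u` be misplaced and `v` correct, with `y v` equal to `y u` or to `x u`. Then exactly one of
`x`, `y` puts `u` and `v` together. At least `S` minus the number of errors such `v` exist for each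
`u`; ordered pairs give the factor 2. -/
lemma le_sqDist_of_errors {n k : ℕ} (x y : Coloring n k) {S : ℝ}
    (hS : ∀ a b, a ≠ b → S ≤ (classSize y a : ℝ) + classSize y b) :
    2 * (errors x y : ℝ) * (S - errors x y) ≤ sqDist x y := by
  classical
  set E := Finset.univ.filter fun v => x v ≠ y v with hE
  set d : Fin n → Fin n → ℝ := fun u v => if (x u = x v ↔ y u = y v) then (0 : ℝ) else 1 with hd
  have hd0 : ∀ u v, 0 ≤ d u v := fun u v => by simp only [hd]; split_ifs <;> norm_num
  have hsymm : ∀ u v, d u v = d v u := fun u v => by simp only [hd, eq_comm]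
  have hrow : ∀ u ∈ E, S - E.card ≤ ∑ v ∈ Eᶜ, d u v := by
    intro u hu
    have hxy : x u ≠ y u := (Finset.mem_filter.1 hu).2
    set G := Finset.univ.filter fun v => y v = y u ∨ y v = x u with hG
    have hGc : (G.card : ℝ) = classSize y (y u) + classSize y (x u) := by
      rw [hG, Finset.filter_or, Finset.card_union_of_disjoint, Nat.cast_add]
      · rfl
      · rw [Finset.disjoint_filter]
        intro v _ h1 h2
        exact hxy (h2.symm.trans h1)
    have h1 : ((G \ E).card : ℝ) ≤ ∑ v ∈ Eᶜ, d u v := by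
      calc ((G \ E).card : ℝ) = ∑ v ∈ G \ E, (1 : ℝ) := by simp
        _ ≤ ∑ v ∈ G \ E, d u v := by
          refine Finset.sum_le_sum fun v hv => ?_
          have hv' := Finset.mem_sdiff.1 hv
          have hvy : x v = y v := by simpa [hE] using hv'.2
          have hvG : y v = y u ∨ y v = x u := by simpa [hG] using hv'.1
          simp only [hd]
          rw [if_neg]
          rw [hvy]
          rcases hvG with h | h
          · rw [h]; simp [hxy]
          · rw [h]; simp [Ne.symm hxy]
        _ ≤ ∑ v ∈ Eᶜ, d u v :=
          Finset.sum_le_sum_of_subset_of_nonneg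
            (fun v hv => Finset.mem_compl.2 (Finset.mem_sdiff.1 hv).2) fun v _ _ => hd0 u v
    have h2 : G.card ≤ (G \ E).card + E.card := by
      have := Finset.le_card_sdiff E G
      omega
    have h3 := hS _ _ (Ne.symm hxy)
    have h2' : (G.card : ℝ) ≤ (G \ E).card + E.card := by exact_mod_cast h2
    linarith
  have hmain : (E.card : ℝ) * (S - E.card) ≤ ∑ u ∈ E, ∑ v ∈ Eᶜ, d u v := by
    rw [← nsmul_eq_mul, ← Finset.sum_const]
    exact Finset.sum_le_sum hrow
  have hsplit : sqDist x y = ∑ u ∈ E, ∑ v, d u v + ∑ u ∈ Eᶜ, ∑ v, d u v := by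
    rw [sqDist_eq_sum, Finset.sum_add_sum_compl]
  have hA : ∑ u ∈ E, ∑ v ∈ Eᶜ, d u v ≤ ∑ u ∈ E, ∑ v, d u v :=
    Finset.sum_le_sum fun u _ => Finset.sum_le_sum_of_subset_of_nonneg
      (Finset.subset_univ _) fun v _ _ => hd0 u v
  have hB : ∑ u ∈ E, ∑ v ∈ Eᶜ, d u v ≤ ∑ u ∈ Eᶜ, ∑ v, d u v := by
    rw [Finset.sum_comm]
    refine Finset.sum_le_sum fun u _ => ?_
    simp_rw [hsymm _ u]
    exact Finset.sum_le_sum_of_subset_of_nonneg (Finset.subset_univ _) fun v _ _ => hd0 u v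
  change 2 * (E.card : ℝ) * (S - E.card) ≤ _
  linarith

lemma card_mul_card_le_sqDist {n k : ℕ} (x y : Coloring n k) (A B : Finset (Fin n))
    (h : ∀ u ∈ A, ∀ v ∈ B, ¬ (x u = x v ↔ y u = y v)) :
    (A.card : ℝ) * B.card ≤ sqDist x y := by
  rw [sqDist_eq_sum]
  have hd0 : ∀ u v, (0 : ℝ) ≤ if (x u = x v ↔ y u = y v) then (0 : ℝ) else 1 :=
    fun u v => by split_ifs <;> norm_num
  calc (A.card : ℝ) * B.card = ∑ u ∈ A, ∑ v ∈ B, (1 : ℝ) := by simp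
    _ = ∑ u ∈ A, ∑ v ∈ B, if (x u = x v ↔ y u = y v) then (0 : ℝ) else 1 := by
      refine Finset.sum_congr rfl fun u hu => Finset.sum_congr rfl fun v hv => ?_
      rw [if_neg (h u hu v hv)]
    _ ≤ ∑ u ∈ A, ∑ v, if (x u = x v ↔ y u = y v) then (0 : ℝ) else 1 :=
      Finset.sum_le_sum fun u _ => Finset.sum_le_sum_of_subset_of_nonneg
        (Finset.subset_univ _) fun v _ _ => hd0 u v
    _ ≤ _ := Finset.sum_le_sum_of_subset_of_nonneg
        (Finset.subset_univ _) fun u _ _ => Finset.sum_nonneg fun v _ => hd0 u v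

/-- By pigeonhole each class `i` of `y` has a cell `T i (f i)` of at least `cn/k` vertices. Two
large cells in different classes with the same `x`-color would create more than `γn²` disagreements,
so `f` is a permutation. Any other cell of class `i` disagrees with the whole large cell and is
therefore small; summing over at most `k²` cells bounds the errors. -/
lemma exists_perm_errors_le {n k : ℕ} (hn : 0 < n) (hk : 0 < k) (x y : Coloring n k) {c γ : ℝ}
    (hc : 0 < c) (hy : ∀ a, c * n ≤ (classSize y a : ℝ)) (hγ : γ < c ^ 2 / k ^ 2)
    (hd : sqDist x y ≤ γ * n ^ 2) :
    ∃ π : Equiv.Perm (Fin k), (errors (π ∘ x) y : ℝ) ≤ γ * k ^ 3 / c * n := by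
  classical
  set T : Fin k → Fin k → Finset (Fin n) :=
    fun i j => Finset.univ.filter fun v => y v = i ∧ x v = j with hT
  have hn' : (0 : ℝ) < n := by exact_mod_cast hn
  have hk' : (0 : ℝ) < k := by exact_mod_cast hk
  have hbig : ∀ i, ∃ j, c * n / k ≤ ((T i j).card : ℝ) := by
    intro i
    by_contra! hcon
    have hsum : (classSize y i : ℝ) = ∑ j, ((T i j).card : ℝ) := by
      have := Finset.card_eq_sum_card_fiberwise (f := x)
        (s := Finset.univ.filter fun v => y v = i) (t := Finset.univ) (fun _ _ => by simp)
      rw [classSize, this, Nat.cast_sum]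
      simp only [hT, Finset.filter_filter]
    have hlt : ∑ j, ((T i j).card : ℝ) < ∑ _j : Fin k, c * n / k :=
      Finset.sum_lt_sum_of_nonempty ⟨⟨0, hk⟩, Finset.mem_univ _⟩ fun j _ => hcon j
    rw [Finset.sum_const, Finset.card_univ, Fintype.card_fin, nsmul_eq_mul,
      mul_div_cancel₀ _ hk'.ne'] at hlt
    linarith [hy i]
  choose f hf using hbig
  have hpos : 0 < c * n / k := by positivity
  have hinj : Function.Injective f := by
    intro i i' hii
    by_contra hne
    have h1 := card_mul_card_le_sqDist x y (T i (f i)) (T i' (f i')) (by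
      intro u hu v hv
      simp only [hT, Finset.mem_filter, Finset.mem_univ, true_and] at hu hv
      rw [hu.1, hu.2, hv.1, hv.2]
      simp [hii, hne])
    have h2 : (c * n / k) * (c * n / k) ≤ ((T i (f i)).card : ℝ) * (T i' (f i')).card :=
      mul_le_mul (hf i) (hf i') hpos.le (by positivity)
    have h3 : γ * n ^ 2 < c ^ 2 / k ^ 2 * n ^ 2 := by gcongr
    have h4 : (c * n / k) * (c * n / k) = c ^ 2 / k ^ 2 * n ^ 2 := by field_simp
    linarith
  have hsmall : ∀ i j, j ≠ f i → ((T i j).card : ℝ) ≤ γ * k / c * n := by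
    intro i j hj
    have h1 := card_mul_card_le_sqDist x y (T i (f i)) (T i j) (by
      intro u hu v hv
      simp only [hT, Finset.mem_filter, Finset.mem_univ, true_and] at hu hv
      rw [hu.1, hu.2, hv.1, hv.2]
      simp [Ne.symm hj])
    have h2 : (c * n / k) * (T i j).card ≤ ((T i (f i)).card : ℝ) * (T i j).card :=
      mul_le_mul_of_nonneg_right (hf i) (by positivity)
    have h3 : γ * k / c * n = γ * n ^ 2 / (c * n / k) := by field_simp
    rw [h3, le_div_iff₀ hpos]
    linarith
  have hbij : Function.Bijective f := Finite.injective_iff_bijective.1 hinj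
  set π := Equiv.ofBijective f hbij with hπ
  refine ⟨π.symm, ?_⟩
  have hγ0 : 0 ≤ γ := by
    have : 0 ≤ γ * n ^ 2 := (sqDist_nonneg x y).trans hd
    by_contra! hneg
    nlinarith [mul_neg_of_neg_of_pos hneg (pow_pos hn' 2)]
  have hsub : (Finset.univ.filter fun v => (π.symm ∘ x) v ≠ y v) ⊆
      Finset.univ.biUnion fun i => (Finset.univ.filter fun j => j ≠ f i).biUnion fun j => T i j := by
    intro v hv
    simp only [Finset.mem_biUnion, Finset.mem_filter, Finset.mem_univ, true_and, hT]
    refine ⟨y v, x v, fun h => ?_, rfl, rfl⟩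
    have hv' := (Finset.mem_filter.1 hv).2
    apply hv'
    rw [Function.comp_apply, Equiv.symm_apply_eq]
    exact h
  have hcard : (errors (π.symm ∘ x) y : ℝ) ≤
      ∑ i, ∑ j ∈ Finset.univ.filter fun j => j ≠ f i, ((T i j).card : ℝ) := by
    have h1 := (Finset.card_le_card hsub).trans Finset.card_biUnion_le
    have h2 := h1.trans (Finset.sum_le_sum fun i _ => Finset.card_biUnion_le)
    exact_mod_cast h2
  refine hcard.trans ?_
  calc ∑ i, ∑ j ∈ Finset.univ.filter fun j => j ≠ f i, ((T i j).card : ℝ)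
      ≤ ∑ i : Fin k, ∑ j ∈ Finset.univ.filter fun j => j ≠ f i, γ * k / c * n :=
        Finset.sum_le_sum fun i _ => Finset.sum_le_sum fun j hj =>
          hsmall i j (Finset.mem_filter.1 hj).2
    _ ≤ ∑ i : Fin k, ∑ j : Fin k, γ * k / c * n :=
        Finset.sum_le_sum fun i _ => Finset.sum_le_sum_of_subset_of_nonneg
          (Finset.subset_univ _) fun _ _ _ => by positivity
    _ = γ * k ^ 3 / c * n := by
        simp only [Finset.sum_const, Finset.card_univ, Fintype.card_fin, nsmul_eq_mul]
        field_simp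

/-- The sum factors over vertices, each contributing at most `1 + kq`. This performs the union bound
over all error counts at once. -/
lemma sum_pow_errors_le {n k : ℕ} (y : Coloring n k) {q : ℝ} (hq : 0 ≤ q) :
    ∑ x : Coloring n k, q ^ errors x y ≤ (1 + k * q) ^ n := by
  classical
  have h1 : ∀ x : Coloring n k, q ^ errors x y = ∏ v, if x v = y v then 1 else q := by
    intro x
    rw [Finset.prod_ite, Finset.prod_const_one, one_mul, Finset.prod_const]
    rfl
  simp_rw [h1]
  have h2 := Finset.prod_univ_sum (fun _ : Fin n => (Finset.univ : Finset (Fin k)))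
    (fun v j => if j = y v then (1 : ℝ) else q)
  rw [Fintype.piFinset_univ] at h2
  rw [← h2]
  calc ∏ v, ∑ j, (if j = y v then (1 : ℝ) else q) ≤ ∏ _v : Fin n, (1 + k * q) := by
        refine Finset.prod_le_prod (fun v _ => Finset.sum_nonneg fun j _ => ?_) fun v _ => ?_
        · split_ifs <;> positivity
        · calc ∑ j, (if j = y v then (1 : ℝ) else q)
              ≤ ∑ j, ((if j = y v then (1 : ℝ) else 0) + q) := by
                refine Finset.sum_le_sum fun j _ => ?_
                split_ifs <;> linarith
            _ = 1 + k * q := by simp [Finset.sum_add_distrib]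
    _ = _ := by simp

/-! ### Exact recovery below the threshold -/

section UpperBound

variable {n k : ℕ} {Ω : Type*} [MeasurableSpace Ω] {P : Measure Ω}
  {W : Ω → Matrix (Fin n) (Fin n) ℝ}

lemma IsGaussianNoise.measure_objective_le (hW : IsGaussianNoise P W) (x y : Coloring n k)
    {σ V : ℝ} (hV : 0 < V) (hσ : σ ^ 2 ≤ V) :
    P {ω | frobeniusNorm (observation y σ (W ω) - kMatrix x) ^ 2 ≤
        frobeniusNorm (observation y σ (W ω) - kMatrix y) ^ 2} ≤
      ENNReal.ofReal (Real.exp (-(sqDist x y / (8 * V)))) := by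
  have hsmul : ∀ (a : ℝ) (A B : Matrix (Fin n) (Fin n) ℝ),
      frobInner (a • A) B = a * frobInner A B := by
    intro a A B
    simp [frobInner, Finset.mul_sum, mul_assoc]
  have hv : frobInner ((2 * σ) • (kMatrix x - kMatrix y)) ((2 * σ) • (kMatrix x - kMatrix y)) ≤
      4 * V * sqDist x y := by
    have : frobInner ((2 * σ) • (kMatrix x - kMatrix y)) ((2 * σ) • (kMatrix x - kMatrix y)) =
        4 * σ ^ 2 * sqDist x y := by
      simp only [frobInner, sqDist, Matrix.smul_apply, smul_eq_mul, Finset.mul_sum]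
      exact Finset.sum_congr rfl fun p _ => by ring
    rw [this]
    have := sqDist_nonneg x y
    gcongr
  refine (measure_mono fun ω hω => ?_).trans
    ((hW.measure_frobInner_ge_le _ (sqDist_nonneg x y) hv).trans
      (ENNReal.ofReal_le_ofReal (Real.exp_le_exp.2 (le_of_eq ?_))))
  · have := objective_sub x y σ (W ω)
    simp only [Set.mem_ofPred_eq] at hω ⊢
    rw [hsmul]
    linarith
  · rcases (sqDist_nonneg x y).eq_or_lt with h | h
    · simp [← h]
    · field_simp
      ring

lemma sum_ne_pow_errors_le (y : Coloring n k) {q : ℝ} (hq : 0 ≤ q) :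
    ∑ x ∈ Finset.univ.filter (fun x : Coloring n k => x ≠ y), q ^ errors x y ≤
      Real.exp (n * (k * q)) - 1 := by
  have h1 := sum_pow_errors_le y hq
  rw [← Finset.sum_filter_add_sum_filter_not _ (fun x : Coloring n k => x ≠ y)] at h1
  have h2 : ∑ x ∈ Finset.univ.filter (fun x : Coloring n k => ¬ x ≠ y), q ^ errors x y = 1 := by
    simp [Finset.filter_eq', errors]
  rw [h2] at h1
  have h3 : (1 + k * q) ^ n ≤ Real.exp (n * (k * q)) := by
    rw [Real.exp_nat_mul]
    gcongr
    linarith [Real.add_one_le_exp (k * q)]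
  linarith

/-- The bound on the probability that a coloring inducing another partition is at least as likely
as the true one. -/
noncomputable def exactRecoveryError (k : ℕ) (δ γ : ℝ) (n : ℕ) : ℝ :=
  (Real.exp (n * (k * Real.exp (-(1 + δ / 2) * Real.log n))) - 1) +
    (k : ℝ) ^ n * Real.exp (-(γ * n * Real.log n / 2))

/-- Only the comparison of `z` with `y` is used, so one bound serves every sample space containing
`y`. -/
lemma IsGaussianNoise.measure_not_samePartition_le (hW : IsGaussianNoise P W) (hn : 2 ≤ n)
    (hk : 0 < k) (y : Coloring n k) (z : Ω → Coloring n k) {c δ γ S σ : ℝ} (hc : 0 < c)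
    (hδ : 0 < δ) (hδ' : δ ≤ 1 / 2)
    (hS : ∀ a b, a ≠ b → S ≤ (classSize y a : ℝ) + classSize y b) (hSn : S ≤ n)
    (hcS : 2 * c * n ≤ S) (hy : ∀ a, c * n ≤ (classSize y a : ℝ))
    (hσ : σ ^ 2 ≤ (1 - δ) * S / (4 * Real.log n)) (hγ0 : 0 < γ) (hγ : γ < c ^ 2 / k ^ 2)
    (hγ' : γ * k ^ 3 / c ≤ δ * c)
    (hz : ∀ ω, frobeniusNorm (observation y σ (W ω) - kMatrix (z ω)) ^ 2 ≤
        frobeniusNorm (observation y σ (W ω) - kMatrix y) ^ 2) :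
    P {ω | ¬ SamePartition (z ω) y} ≤ ENNReal.ofReal (exactRecoveryError k δ γ n) := by
  classical
  have hn1 : (1 : ℝ) < n := by exact_mod_cast hn
  have hn0 : (0 : ℝ) < n := by linarith
  have hL : 0 < Real.log n := Real.log_pos hn1
  have hS0 : 0 < S := lt_of_lt_of_le (by positivity) hcS
  set L := Real.log n with hLdef
  have hδ1 : 0 < 1 - δ := by linarith
  set V := (1 - δ) * S / (4 * L) with hV
  have hV0 : 0 < V := by positivity
  set q := Real.exp (-(1 + δ / 2) * L) with hq
  set E : Coloring n k → Set Ω := fun x =>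
    {ω | frobeniusNorm (observation y σ (W ω) - kMatrix x) ^ 2 ≤
        frobeniusNorm (observation y σ (W ω) - kMatrix y) ^ 2} with hE
  set F := Finset.univ.filter (fun x : Coloring n k => γ * n ^ 2 < sqDist x y) with hF
  set G := Finset.univ.filter
    (fun x : Coloring n k => x ≠ y ∧ (errors x y : ℝ) ≤ γ * k ^ 3 / c * n) with hG
  have hsub : {ω | ¬ SamePartition (z ω) y} ⊆ (⋃ x ∈ G, E x) ∪ ⋃ x ∈ F, E x := by
    intro ω hω
    by_cases hd : γ * n ^ 2 < sqDist (z ω) y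
    · exact Or.inr (Set.mem_biUnion (show z ω ∈ (F : Set _) by simp [hF, hd]) (hz ω))
    · left
      obtain ⟨π, hπ⟩ := exists_perm_errors_le (by omega) hk (z ω) y hc hy hγ (not_lt.1 hd)
      refine Set.mem_biUnion (x := π ∘ z ω) ?_ ?_
      · simp only [hG, Finset.coe_filter, Finset.mem_univ, true_and, Set.mem_ofPred_eq]
        refine ⟨fun h => hω ?_, hπ⟩
        rw [← kMatrix_eq_iff, ← h, kMatrix_comp]
      -- Relabeling leaves the matrix unchanged, so the relabeled estimate is still at least as good
      -- as `y`.
      · simp only [hE, Set.mem_ofPred_eq, kMatrix_comp]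
        exact hz ω
  have hGbound : ∀ x ∈ G, P (E x) ≤ ENNReal.ofReal (q ^ errors x y) := by
    intro x hx
    refine (hW.measure_objective_le x y hV0 hσ).trans (ENNReal.ofReal_le_ofReal ?_)
    rw [hq, ← Real.exp_nat_mul]
    apply Real.exp_le_exp.2
    have h1 := le_sqDist_of_errors x y hS
    set h := (errors x y : ℝ) with hh
    have hh0 : 0 ≤ h := by positivity
    -- From `γk³/c ≤ δc` and `2cn ≤ S`.
    have h2 : h ≤ δ / 2 * S := by
      have := (Finset.mem_filter.1 hx).2.2
      have h3 : γ * k ^ 3 / c * n ≤ δ * c * n := by gcongr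
      nlinarith
    have h3 : h * (1 + δ / 2) * L ≤ sqDist x y / (8 * V) := by
      rw [le_div_iff₀ (by positivity)]
      have h4 : h * (1 + δ / 2) * L * (8 * V) = 2 * h * ((1 + δ / 2) * (1 - δ) * S) := by
        rw [hV]; field_simp; ring
      rw [h4]
      refine le_trans ?_ h1
      -- What remains follows from `(1 + δ/2)(1 - δ) ≤ 1 - δ/2` and `h ≤ δS/2`.
      refine mul_le_mul_of_nonneg_left ?_ (by positivity)
      nlinarith [mul_pos hδ hδ]
    linarith
  have hFbound : ∀ x ∈ F, P (E x) ≤ ENNReal.ofReal (Real.exp (-(γ * n * L / 2))) := by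
    intro x hx
    refine (hW.measure_objective_le x y hV0 hσ).trans (ENNReal.ofReal_le_ofReal ?_)
    apply Real.exp_le_exp.2
    have h1 : γ * n ^ 2 < sqDist x y := (Finset.mem_filter.1 hx).2
    have h2 : γ * n * L / 2 ≤ sqDist x y / (8 * V) := by
      rw [le_div_iff₀ (by positivity)]
      have h4 : γ * n * L / 2 * (8 * V) = γ * n * ((1 - δ) * S) := by
        rw [hV]; field_simp; ring
      rw [h4]
      have h5 : (1 - δ) * S ≤ n := by nlinarith
      have h6 : γ * n * ((1 - δ) * S) ≤ γ * n * n := by gcongr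
      nlinarith
    linarith
  calc P {ω | ¬ SamePartition (z ω) y} ≤ P ((⋃ x ∈ G, E x) ∪ ⋃ x ∈ F, E x) := measure_mono hsub
    _ ≤ ∑ x ∈ G, P (E x) + ∑ x ∈ F, P (E x) :=
      (measure_union_le _ _).trans
        (add_le_add (measure_biUnion_finset_le _ _) (measure_biUnion_finset_le _ _))
    _ ≤ ∑ x ∈ G, ENNReal.ofReal (q ^ errors x y) +
        ∑ _x ∈ F, ENNReal.ofReal (Real.exp (-(γ * n * L / 2))) :=
      add_le_add (Finset.sum_le_sum hGbound) (Finset.sum_le_sum hFbound)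
    _ = ENNReal.ofReal (∑ x ∈ G, q ^ errors x y + ∑ _x ∈ F, Real.exp (-(γ * n * L / 2))) := by
      have hq0 : 0 ≤ q := (Real.exp_pos _).le
      rw [← ENNReal.ofReal_sum_of_nonneg fun _ _ => by positivity,
        ← ENNReal.ofReal_sum_of_nonneg fun _ _ => by positivity, ENNReal.ofReal_add]
      · exact Finset.sum_nonneg fun _ _ => by positivity
      · exact Finset.sum_nonneg fun _ _ => by positivity
    _ ≤ _ := by
      have hq0 : 0 ≤ q := (Real.exp_pos _).le
      refine ENNReal.ofReal_le_ofReal (add_le_add ?_ ?_)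
      · refine le_trans (Finset.sum_le_sum_of_subset_of_nonneg ?_ fun _ _ _ => by positivity)
          (sum_ne_pow_errors_le y hq0)
        exact Finset.monotone_filter_right _ fun x _ hx => hx.1
      · rw [Finset.sum_const, nsmul_eq_mul]
        gcongr
        have : F.card ≤ k ^ n := by
          refine (Finset.card_le_univ F).trans (le_of_eq ?_)
          simp
        exact_mod_cast this

end UpperBound

/-- The exponent in the first term is `k n^{-δ/2}`; in the second, `γnL/2` outgrows `n(k + 1)`. -/
lemma tendsto_exactRecoveryError (k : ℕ) {δ γ : ℝ} (hδ : 0 < δ) (hγ : 0 < γ) :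
    Tendsto (exactRecoveryError k δ γ) atTop (𝓝 0) := by
  have hlog : Tendsto (fun n : ℕ => Real.log n) atTop atTop :=
    Real.tendsto_log_atTop.comp tendsto_natCast_atTop_atTop
  have h1 : Tendsto (fun n : ℕ => Real.exp (n * (k * Real.exp (-(1 + δ / 2) * Real.log n))) - 1)
      atTop (𝓝 0) := by
    have h2 : Tendsto (fun n : ℕ => (k : ℝ) * Real.exp (-(δ / 2 * Real.log n))) atTop (𝓝 0) := by
      have := (Real.tendsto_exp_neg_atTop_nhds_zero.comp
        (hlog.const_mul_atTop (half_pos hδ))).const_mul (k : ℝ)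
      simpa using this
    have h3 : Tendsto (fun n : ℕ => (n : ℝ) * (k * Real.exp (-(1 + δ / 2) * Real.log n)))
        atTop (𝓝 0) := by
      refine h2.congr' ?_
      filter_upwards [eventually_gt_atTop 0] with n hn
      have hn0 : (0 : ℝ) < n := by exact_mod_cast hn
      have : Real.exp (-(1 + δ / 2) * Real.log n) =
          Real.exp (-(δ / 2 * Real.log n)) * (n : ℝ)⁻¹ := by
        rw [show -(1 + δ / 2) * Real.log n = -(δ / 2 * Real.log n) + -Real.log n by ring,
          Real.exp_add, Real.exp_neg (Real.log n), Real.exp_log hn0]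
      rw [this]
      field_simp
    have h4 := (Real.continuous_exp.tendsto 0).comp h3
    simpa using h4.sub_const 1
  have h5 : Tendsto (fun n : ℕ => (k : ℝ) ^ n * Real.exp (-(γ * n * Real.log n / 2)))
      atTop (𝓝 0) := by
    have h6 : Tendsto (fun n : ℕ => Real.exp (-(n : ℝ))) atTop (𝓝 0) :=
      Real.tendsto_exp_neg_atTop_nhds_zero.comp tendsto_natCast_atTop_atTop
    refine squeeze_zero' (Eventually.of_forall fun n => by positivity) ?_ h6
    have h7 := hlog.eventually_ge_atTop (2 / γ * (k + 1))
    filter_upwards [h7] with n hn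
    have h8 : (k : ℝ) ^ n ≤ Real.exp (n * k) := by
      rw [Real.exp_nat_mul]
      gcongr
      linarith [Real.add_one_le_exp (k : ℝ)]
    have h9 : (k + 1 : ℝ) ≤ γ * Real.log n / 2 := by
      rw [div_mul_eq_mul_div, div_le_iff₀ hγ] at hn
      linarith
    calc (k : ℝ) ^ n * Real.exp (-(γ * n * Real.log n / 2))
        ≤ Real.exp (n * k) * Real.exp (-(γ * n * Real.log n / 2)) := by gcongr
      _ = Real.exp (n * k + -(γ * n * Real.log n / 2)) := (Real.exp_add _ _).symm
      _ ≤ Real.exp (-(n : ℝ)) := by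
        apply Real.exp_le_exp.2
        have := mul_le_mul_of_nonneg_left h9 (Nat.cast_nonneg (α := ℝ) n)
        linarith
  have h10 := h1.add h5
  rw [add_zero] at h10
  exact h10

/-! ### Swapping two vertices, and splitting its noise -/

section Swap

variable {n k : ℕ}

lemma classSize_comp_perm (y : Coloring n k) (π : Equiv.Perm (Fin n)) (a : Fin k) :
    classSize (y ∘ π) a = classSize y a := by
  refine Finset.card_bij (fun v _ => π v) (fun v hv => by simpa using hv)
    (fun v _ w _ h => π.injective h) fun v hv => ⟨π.symm v, by simpa using hv, by simp⟩

/-- The coefficients, in row and column `i` and outside `H`, of the noise in the change of the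
objective when vertex `i` moves from color `a` to color `b`. -/
def moveMatrix (y : Coloring n k) (a b : Fin k) (H : Finset (Fin n)) (i : Fin n) :
    Matrix (Fin n) (Fin n) ℝ :=
  Matrix.of fun u v =>
    if u = i ∧ v ∉ H then (if y v = a then 1 else if y v = b then -1 else 0)
    else if v = i ∧ u ∉ H then (if y u = a then 1 else if y u = b then -1 else 0) else 0

/-- The supports are disjoint: each nonzero entry has one index equal to the moved vertex and the
other outside `H`, while `i` lies in `H`. -/
lemma frobInner_moveMatrix_of_ne (y : Coloring n k) (a b : Fin k) (H : Finset (Fin n))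
    {i j : Fin n} (hi : i ∈ H) (hij : i ≠ j) :
    frobInner (moveMatrix y a b H i) (moveMatrix y a b H j) = 0 := by
  refine Finset.sum_eq_zero fun p _ => ?_
  obtain ⟨u, v⟩ := p
  simp only [moveMatrix, Matrix.of_apply]
  by_cases h1 : u = i ∧ v ∉ H
  · rw [if_neg (c := u = j ∧ v ∉ H) (fun h => hij (h1.1.symm.trans h.1)),
      if_neg (c := v = j ∧ u ∉ H) (fun h => h.2 (h1.1 ▸ hi)), mul_zero]
  · rw [if_neg h1]
    by_cases h2 : v = i ∧ u ∉ H
    · rw [if_neg (c := u = j ∧ v ∉ H) (fun h => h.2 (h2.1 ▸ hi)),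
        if_neg (c := v = j ∧ u ∉ H) (fun h => hij (h2.1.symm.trans h.1)), mul_zero]
    · rw [if_neg h2, zero_mul]

lemma card_filter_or_eq (y : Coloring n k) {a b : Fin k} (hab : a ≠ b) :
    (Finset.univ.filter fun v => y v = a ∨ y v = b).card = classSize y a + classSize y b := by
  rw [Finset.filter_or, Finset.card_union_of_disjoint]
  · rfl
  · rw [Finset.disjoint_filter]
    intro v _ h1 h2
    exact hab (h1.symm.trans h2)

lemma le_frobInner_moveMatrix (y : Coloring n k) {a b : Fin k} (hab : a ≠ b)
    (H : Finset (Fin n)) {i : Fin n} (hi : i ∈ H) :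
    2 * ((classSize y a : ℝ) + classSize y b - H.card) ≤
      frobInner (moveMatrix y a b H i) (moveMatrix y a b H i) := by
  classical
  set G := (Finset.univ.filter fun v => y v = a ∨ y v = b) \ H with hG
  have hcard : (classSize y a : ℝ) + classSize y b - H.card ≤ G.card := by
    have h2 : classSize y a + classSize y b ≤ G.card + H.card := by
      rw [← card_filter_or_eq y hab, ← Nat.sub_le_iff_le_add]
      exact Finset.le_card_sdiff H _
    have h3 : (classSize y a : ℝ) + classSize y b ≤ G.card + H.card := by exact_mod_cast h2
    linarith
  have hpt : ∀ u v, ((if u = i ∧ v ∈ G then (1 : ℝ) else 0) + if v = i ∧ u ∈ G then 1 else 0) ≤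
      moveMatrix y a b H i u v * moveMatrix y a b H i u v := by
    intro u v
    simp only [moveMatrix, Matrix.of_apply, hG, Finset.mem_sdiff, Finset.mem_filter,
      Finset.mem_univ, true_and]
    by_cases hu : u = i <;> by_cases hv : v = i
    · simp [hu, hv, hi]
    · simp only [hu, hv, hi, true_and, false_and, if_false]
      split_ifs <;> simp_all
    · simp only [hu, hv, hi, true_and, false_and, if_false]
      split_ifs <;> simp_all
    · simp [hu, hv]
  have hsum : ∑ u, ∑ v, ((if u = i ∧ v ∈ G then (1 : ℝ) else 0) +
      if v = i ∧ u ∈ G then 1 else 0) = 2 * G.card := by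
    simp only [Finset.sum_add_distrib, ite_and]
    simp
    ring
  rw [frobInner, Fintype.sum_prod_type]
  have := Finset.sum_le_sum fun u (_ : u ∈ Finset.univ) =>
    Finset.sum_le_sum fun v (_ : v ∈ Finset.univ) => hpt u v
  linarith

lemma sum_indicator_cross_le (i j : Fin n) (H : Finset (Fin n)) :
    ∑ u, ∑ v, ((if u = i ∧ v ∈ H then (1 : ℝ) else 0) + (if u = j ∧ v ∈ H then 1 else 0) +
      ((if v = i ∧ u ∈ H then 1 else 0) + if v = j ∧ u ∈ H then 1 else 0)) = 4 * H.card := by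
  simp only [Finset.sum_add_distrib, ite_and]
  simp
  ring

lemma kMatrix_swap_sub (y : Coloring n k) {a b : Fin k} {i j : Fin n} (hi : y i = a)
    (hj : y j = b) (u v : Fin n) :
    (kMatrix (y ∘ Equiv.swap i j) - kMatrix y) u v =
      (if (if u = i then b else if u = j then a else y u) ≠
        (if v = i then b else if v = j then a else y v) then 1 else 0) -
        if y u ≠ y v then 1 else 0 := by
  have h : ∀ w, (y ∘ Equiv.swap i j) w = if w = i then b else if w = j then a else y w := by
    intro w
    simp only [Function.comp_apply, Equiv.swap_apply_def]
    split_ifs <;> simp_all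
  simp only [kMatrix, Matrix.sub_apply, Matrix.of_apply, h]

/-- Entries change only in the rows and columns of `i` and `j`, and only against vertices of the two
classes involved. -/
lemma sqDist_swap_le (y : Coloring n k) {a b : Fin k} (hab : a ≠ b) {i j : Fin n} (hi : y i = a)
    (hj : y j = b) :
    sqDist (y ∘ Equiv.swap i j) y ≤ 4 * ((classSize y a : ℝ) + classSize y b) := by
  classical
  have hij : i ≠ j := fun h => hab (hi.symm.trans (h ▸ hj))
  set G := Finset.univ.filter fun v => y v = a ∨ y v = b with hG
  have hpt : ∀ u v, (kMatrix (y ∘ Equiv.swap i j) - kMatrix y) u v *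
      (kMatrix (y ∘ Equiv.swap i j) - kMatrix y) u v ≤
      ((if u = i ∧ v ∈ G then (1 : ℝ) else 0) + (if u = j ∧ v ∈ G then 1 else 0) +
      ((if v = i ∧ u ∈ G then 1 else 0) + if v = j ∧ u ∈ G then 1 else 0)) := by
    intro u v
    rw [kMatrix_swap_sub y hi hj]
    simp only [hG, Finset.mem_filter, Finset.mem_univ, true_and]
    have hji := hij.symm
    have hba := hab.symm
    by_cases hui : u = i
    · subst hui
      by_cases hvi : v = u
      · simp_all
      by_cases hvj : v = j
      · simp_all
      by_cases hva : y v = a <;> by_cases hvb : y v = b <;> simp_all [eq_comm]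
    by_cases huj : u = j
    · subst huj
      by_cases hvi : v = i
      · simp_all
      by_cases hvj : v = u
      · simp_all
      by_cases hva : y v = a <;> by_cases hvb : y v = b <;> simp_all [eq_comm]
    by_cases hvi : v = i
    · subst hvi
      by_cases hua : y u = a <;> by_cases hub : y u = b <;> simp_all
    by_cases hvj : v = j
    · subst hvj
      by_cases hua : y u = a <;> by_cases hub : y u = b <;> simp_all
    simp [hui, huj, hvi, hvj]
  rw [sqDist, frobInner, Fintype.sum_prod_type]
  have h1 := Finset.sum_le_sum fun u (_ : u ∈ Finset.univ) =>
    Finset.sum_le_sum fun v (_ : v ∈ Finset.univ) => hpt u v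
  rw [sum_indicator_cross_le, hG, card_filter_or_eq y hab] at h1
  exact_mod_cast h1

/-- The part of the noise coefficients of a swap that is not covered by the two moves. -/
def swapRest (y : Coloring n k) (a b : Fin k) (H : Finset (Fin n)) (i j : Fin n) :
    Matrix (Fin n) (Fin n) ℝ :=
  kMatrix (y ∘ Equiv.swap i j) - kMatrix y - moveMatrix y a b H i + moveMatrix y a b H j

/-- Against vertices outside `H` the two moves account for the swap exactly. What is left lies in
the rows and columns of `i` and `j` within `H`, with entries of size at most 1. -/
lemma frobInner_swapRest_le (y : Coloring n k) {a b : Fin k} (hab : a ≠ b) (H : Finset (Fin n))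
    {i j : Fin n} (hi : y i = a) (hj : y j = b) (hiH : i ∈ H) (hjH : j ∈ H) :
    frobInner (swapRest y a b H i j) (swapRest y a b H i j) ≤ 4 * H.card := by
  have hij : i ≠ j := fun h => hab (hi.symm.trans (h ▸ hj))
  have hpt : ∀ u v, swapRest y a b H i j u v * swapRest y a b H i j u v ≤
      ((if u = i ∧ v ∈ H then (1 : ℝ) else 0) + (if u = j ∧ v ∈ H then 1 else 0) +
      ((if v = i ∧ u ∈ H then 1 else 0) + if v = j ∧ u ∈ H then 1 else 0)) := by
    intro u v
    rw [swapRest, Matrix.add_apply, Matrix.sub_apply, kMatrix_swap_sub y hi hj]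
    simp only [moveMatrix, Matrix.of_apply]
    by_cases hu : u ∈ H <;> by_cases hv : v ∈ H
    · simp only [hu, hv, not_true_eq_false, and_false, and_true, if_false]
      by_cases h1 : u = i ∨ u = j ∨ v = i ∨ v = j
      · have hle : ∀ p q : Prop, ∀ [Decidable p] [Decidable q],
            ((if p then (1 : ℝ) else 0) - (if q then 1 else 0) - 0 + 0) *
              ((if p then (1 : ℝ) else 0) - (if q then 1 else 0) - 0 + 0) ≤ 1 := by
          intro p q _ _
          split_ifs <;> norm_num
        refine (hle _ _).trans ?_
        rcases h1 with rfl | rfl | rfl | rfl <;> simp only [if_true] <;> split_ifs <;> norm_num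
      · push Not at h1
        simp [h1]
    · have h1 : v ≠ i := fun h => hv (h ▸ hiH)
      have h2 : v ≠ j := fun h => hv (h ▸ hjH)
      simp only [hu, hv, h1, h2, not_true_eq_false, not_false_eq_true, and_false, and_true,
        if_false]
      have hji := hij.symm
      have hba := hab.symm
      by_cases hui : u = i
      · subst hui
        by_cases hva : y v = a <;> by_cases hvb : y v = b <;> simp_all [eq_comm]
      by_cases huj : u = j
      · subst huj
        by_cases hva : y v = a <;> by_cases hvb : y v = b <;> simp_all [eq_comm]
      simp [hui, huj]
    · have h1 : u ≠ i := fun h => hu (h ▸ hiH)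
      have h2 : u ≠ j := fun h => hu (h ▸ hjH)
      simp only [hu, hv, h1, h2, not_true_eq_false, not_false_eq_true, and_false, and_true,
        if_false]
      have hji := hij.symm
      have hba := hab.symm
      by_cases hvi : v = i
      · subst hvi
        by_cases hua : y u = a <;> by_cases hub : y u = b <;> simp_all
      by_cases hvj : v = j
      · subst hvj
        by_cases hua : y u = a <;> by_cases hub : y u = b <;> simp_all
      simp [hvi, hvj]
    · have h1 : v ≠ i := fun h => hv (h ▸ hiH)
      have h2 : v ≠ j := fun h => hv (h ▸ hjH)
      have h3 : u ≠ i := fun h => hu (h ▸ hiH)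
      have h4 : u ≠ j := fun h => hu (h ▸ hjH)
      simp [hu, hv, h1, h2, h3, h4]
  rw [frobInner, Fintype.sum_prod_type]
  have h1 := Finset.sum_le_sum fun u (_ : u ∈ Finset.univ) =>
    Finset.sum_le_sum fun v (_ : v ∈ Finset.univ) => hpt u v
  rwa [sum_indicator_cross_le] at h1

lemma frobInner_swap (y : Coloring n k) (a b : Fin k) (H : Finset (Fin n)) (i j : Fin n)
    (W : Matrix (Fin n) (Fin n) ℝ) :
    frobInner (kMatrix (y ∘ Equiv.swap i j) - kMatrix y) W =
      frobInner (moveMatrix y a b H i) W + frobInner (-moveMatrix y a b H j) W -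
        frobInner (-swapRest y a b H i j) W := by
  simp only [frobInner, ← Finset.sum_add_distrib, ← Finset.sum_sub_distrib]
  refine Finset.sum_congr rfl fun p _ => ?_
  simp only [swapRest, Matrix.add_apply, Matrix.sub_apply, Matrix.neg_apply]
  ring

end Swap

/-! ### Failure of recovery above the threshold -/

section LowerBound

variable {n k : ℕ} {Ω : Type*} [MeasurableSpace Ω] {P : Measure Ω}
  {W : Ω → Matrix (Fin n) (Fin n) ℝ}

/-- If no swap improves, then all `i`-terms are at most the threshold, or all `j`-terms are, or some
remainder reaches `T`. A union bound over these events needs independence only within each family.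
-/
lemma IsGaussianNoise.measure_forall_swap_ge_le (hW : IsGaussianNoise P W) (y : Coloring n k)
    {a b : Fin k} (hab : a ≠ b) {HA HB : Finset (Fin n)} (hHA : ∀ i ∈ HA, y i = a)
    (hHB : ∀ j ∈ HB, y j = b) {h : ℕ} (hA : HA.card = h) (hB : HB.card = h) {σ T τ : ℝ}
    (hσ : 0 < σ) (hT : 0 ≤ T) (hτ : 0 ≤ τ)
    (hpos : 0 < (classSize y a : ℝ) + classSize y b - 2 * h)
    (hthr : ((classSize y a : ℝ) + classSize y b) / σ + T / 2 ≤
      τ * Real.sqrt (2 * ((classSize y a : ℝ) + classSize y b - 2 * h))) :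
    P {ω | ∀ i ∈ HA, ∀ j ∈ HB, frobeniusNorm (observation y σ (W ω) - kMatrix y) ^ 2 ≤
        frobeniusNorm (observation y σ (W ω) - kMatrix (y ∘ Equiv.swap i j)) ^ 2} ≤
      ENNReal.ofReal
        (2 * Real.exp (-(h * (Real.exp (-(τ + 1) ^ 2 / 2) / Real.sqrt (2 * Real.pi)))) +
          (h : ℝ) ^ 2 * Real.exp (-T ^ 2 / (2 * (8 * h)))) := by
  classical
  set S := (classSize y a : ℝ) + classSize y b with hS
  -- Two terms above `thr` and a remainder below `T` sum to more than `2S/σ`, which beats the cost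
  -- `4S` after multiplication by `2σ`.
  set thr := S / σ + T / 2 with hthrdef
  set H := HA ∪ HB with hH
  have hdisj : Disjoint HA HB := by
    rw [Finset.disjoint_left]
    intro v h1 h2
    exact hab ((hHA v h1).symm.trans (hHB v h2))
  have hHc : (H.card : ℝ) = 2 * h := by
    rw [hH, Finset.card_union_of_disjoint hdisj, hA, hB]
    push_cast
    ring
  have hAH : ∀ i ∈ HA, i ∈ H := fun i hi => Finset.mem_union_left _ hi
  have hBH : ∀ i ∈ HB, i ∈ H := fun i hi => Finset.mem_union_right _ hi
  set bA : Set Ω := {ω | ∀ i ∈ HA, frobInner (moveMatrix y a b H i) (W ω) ≤ thr} with hbA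
  set bB : Set Ω := {ω | ∀ j ∈ HB, frobInner (-moveMatrix y a b H j) (W ω) ≤ thr} with hbB
  set bR : Fin n × Fin n → Set Ω :=
    fun p => {ω | T ≤ frobInner (-swapRest y a b H p.1 p.2) (W ω)} with hbR
  have hneg : ∀ A B : Matrix (Fin n) (Fin n) ℝ, frobInner (-A) (-B) = frobInner A B := by
    intro A B
    simp [frobInner]
  have hsub : {ω | ∀ i ∈ HA, ∀ j ∈ HB, frobeniusNorm (observation y σ (W ω) - kMatrix y) ^ 2 ≤
        frobeniusNorm (observation y σ (W ω) - kMatrix (y ∘ Equiv.swap i j)) ^ 2} ⊆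
      (bA ∪ bB) ∪ ⋃ p ∈ HA ×ˢ HB, bR p := by
    intro ω hω
    by_contra hcon
    simp only [Set.mem_union, not_or, hbA, hbB, hbR, Set.mem_iUnion, Set.mem_ofPred_eq,
      not_forall, not_le, not_exists, Finset.mem_product] at hcon
    obtain ⟨⟨⟨i, hi, h1⟩, ⟨j, hj, h2⟩⟩, h3⟩ := hcon
    have h4 := h3 (i, j) ⟨hi, hj⟩
    have h5 := hω i hi j hj
    have h6 := objective_sub (y ∘ Equiv.swap i j) y σ (W ω)
    have h7 := sqDist_swap_le y hab (hHA i hi) (hHB j hj)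
    rw [frobInner_swap y a b H i j (W ω)] at h6
    set Y1 := frobInner (moveMatrix y a b H i) (W ω)
    set Y2 := frobInner (-moveMatrix y a b H j) (W ω)
    set Y3 := frobInner (-swapRest y a b H i j) (W ω)
    have h8 : 2 * (S / σ) < Y1 + Y2 - Y3 := by
      linarith
    have h9 : 2 * σ * (2 * (S / σ)) < 2 * σ * (Y1 + Y2 - Y3) :=
      mul_lt_mul_of_pos_left h8 (by positivity)
    have h10 : 2 * σ * (2 * (S / σ)) = 4 * S := by field_simp; ring
    linarith
  have hvA : ∀ i ∈ H, 2 * (S - 2 * h) ≤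
      frobInner (moveMatrix y a b H i) (moveMatrix y a b H i) := by
    intro i hi
    rw [← hHc]
    exact le_frobInner_moveMatrix y hab H hi
  set E1 := Real.exp (-(h * (Real.exp (-(τ + 1) ^ 2 / 2) / Real.sqrt (2 * Real.pi)))) with hE1
  have hPA : P bA ≤ ENNReal.ofReal E1 := by
    have := hW.measure_forall_frobInner_le HA (moveMatrix y a b H)
      (fun i hi j _ hij => frobInner_moveMatrix_of_ne y a b H (hAH i hi) hij)
      (v := 2 * (S - 2 * h)) (by linarith) (fun i hi => hvA i (hAH i hi)) hτ hthr
    rwa [hA] at this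
  have hPB : P bB ≤ ENNReal.ofReal E1 := by
    have := hW.measure_forall_frobInner_le HB (fun j => -moveMatrix y a b H j)
      (fun i hi j _ hij => by
        rw [hneg, frobInner_moveMatrix_of_ne y a b H (hBH i hi) hij])
      (v := 2 * (S - 2 * h)) (by linarith)
      (fun i hi => by rw [hneg]; exact hvA i (hBH i hi)) hτ hthr
    rwa [hB] at this
  set E2 := Real.exp (-T ^ 2 / (2 * (8 * h))) with hE2
  have hPR : ∀ p ∈ HA ×ˢ HB, P (bR p) ≤ ENNReal.ofReal E2 := by
    intro p hp
    obtain ⟨h1, h2⟩ := Finset.mem_product.1 hp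
    refine hW.measure_frobInner_ge_le _ hT ?_
    rw [hneg]
    refine (frobInner_swapRest_le y hab H (hHA _ h1) (hHB _ h2) (hAH _ h1) (hBH _ h2)).trans ?_
    rw [hHc]
    linarith
  calc _ ≤ P ((bA ∪ bB) ∪ ⋃ p ∈ HA ×ˢ HB, bR p) := measure_mono hsub
    _ ≤ (P bA + P bB) + ∑ p ∈ HA ×ˢ HB, P (bR p) :=
      (measure_union_le _ _).trans
        (add_le_add (measure_union_le _ _) (measure_biUnion_finset_le _ _))
    _ ≤ (ENNReal.ofReal E1 + ENNReal.ofReal E1) + ∑ _p ∈ HA ×ˢ HB, ENNReal.ofReal E2 :=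
      add_le_add (add_le_add hPA hPB) (Finset.sum_le_sum hPR)
    _ = ENNReal.ofReal (E1 + E1 + ∑ _p ∈ HA ×ˢ HB, E2) := by
      have hE10 : 0 ≤ E1 := (Real.exp_pos _).le
      have hE20 : 0 ≤ E2 := (Real.exp_pos _).le
      rw [← ENNReal.ofReal_sum_of_nonneg fun _ _ => hE20, ← ENNReal.ofReal_add hE10 hE10,
        ← ENNReal.ofReal_add (by positivity) (Finset.sum_nonneg fun _ _ => hE20)]
    _ = _ := by
      congr 1
      rw [Finset.sum_const, Finset.card_product, hA, hB, nsmul_eq_mul]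
      push_cast
      ring

/-- The bound on the probability that no swap across the two smallest classes improves on the true
coloring. -/
noncomputable def noSwapError (c ε : ℝ) (n : ℕ) : ℝ :=
  2 * Real.exp (-(⌊ε * c * n⌋₊ * (Real.exp (-(Real.sqrt (2 * (1 - ε) * Real.log n) + 1) ^ 2 / 2) /
    Real.sqrt (2 * Real.pi)))) + (n : ℝ)⁻¹

lemma IsGaussianNoise.measure_forall_swap_ge_le_noSwapError (hW : IsGaussianNoise P W)
    (hn : 2 ≤ n) (y : Coloring n k) {a b : Fin k} (hab : a ≠ b) {c δ ε σ : ℝ} (hc : 0 < c)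
    (hδ : 0 < δ) (hε : 0 < ε) (hε1 : ε < 1) (ha : c * n ≤ (classSize y a : ℝ))
    (hb : c * n ≤ (classSize y b : ℝ)) (hfloor : 1 ≤ ⌊ε * c * n⌋₊)
    (hεδ : 2 / Real.sqrt (1 + δ) + Real.sqrt (6 * ε) ≤ 2 * (1 - ε)) (hσ : 0 < σ)
    (hσ' : (1 + δ) * ((classSize y a : ℝ) + classSize y b) / (4 * Real.log n) < σ ^ 2) :
    P {ω | ∀ i j, y i = a → y j = b → frobeniusNorm (observation y σ (W ω) - kMatrix y) ^ 2 ≤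
        frobeniusNorm (observation y σ (W ω) - kMatrix (y ∘ Equiv.swap i j)) ^ 2} ≤
      ENNReal.ofReal (noSwapError c ε n) := by
  classical
  have hn1 : (1 : ℝ) < n := by exact_mod_cast hn
  have hn0 : (0 : ℝ) < n := by linarith
  have hL : 0 < Real.log n := Real.log_pos hn1
  set L := Real.log n with hLdef
  set h := ⌊ε * c * n⌋₊ with hh
  have hh1 : (1 : ℝ) ≤ h := by exact_mod_cast hfloor
  have hhle : (h : ℝ) ≤ ε * c * n := Nat.floor_le (by positivity)
  have hcn : 0 < c * n := by positivity
  have hhle' : (h : ℝ) ≤ c * n := by nlinarith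
  have hhA : h ≤ classSize y a := by exact_mod_cast hhle'.trans ha
  have hhB : h ≤ classSize y b := by exact_mod_cast hhle'.trans hb
  obtain ⟨HA, hHA, hHAc⟩ := Finset.exists_subset_card_eq hhA
  obtain ⟨HB, hHB, hHBc⟩ := Finset.exists_subset_card_eq hhB
  have hhn : (h : ℝ) ≤ n := by
    have h1 : h ≤ n := by
      rw [← hHAc]
      exact (Finset.card_le_univ _).trans (by simp)
    exact_mod_cast h1
  set S := (classSize y a : ℝ) + classSize y b with hS
  have hhS : 2 * (h : ℝ) ≤ ε * S := by
    have : ε * (2 * (c * n)) ≤ ε * S := by gcongr; linarith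
    linarith
  have hS0 : 0 < S := by linarith
  have hε1' : 0 < 1 - ε := by linarith
  have hv : 2 * (1 - ε) * S ≤ 2 * (S - 2 * h) := by linarith
  -- Chosen so that `T²/(16h) = 3L`: each remainder then fails with probability at most `n⁻³`,
  -- against at most `n²` pairs.
  set T := Real.sqrt (48 * h * L) with hT
  -- Slightly below `√(2L)`, so that about `εcn` independent terms exceed level `τ` somewhere with
  -- high probability.
  set τ := Real.sqrt (2 * (1 - ε) * L) with hτ
  have hSL : Real.sqrt (S * L) = Real.sqrt S * Real.sqrt L := Real.sqrt_mul hS0.le L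
  have hthr : S / σ + T / 2 ≤ τ * Real.sqrt (2 * (S - 2 * h)) := by
    have h1 : S / σ ≤ 2 / Real.sqrt (1 + δ) * Real.sqrt (S * L) := by
      rw [div_le_iff₀ hσ]
      have h2 : Real.sqrt ((1 + δ) * S / (4 * L)) ≤ σ :=
        Real.sqrt_le_iff.2 ⟨hσ.le, hσ'.le⟩
      have h3 : S = 2 / Real.sqrt (1 + δ) * Real.sqrt (S * L) *
          Real.sqrt ((1 + δ) * S / (4 * L)) := by
        have h4 : Real.sqrt (4 * L) = 2 * Real.sqrt L := by
          rw [Real.sqrt_mul (by norm_num), show (4 : ℝ) = 2 ^ 2 by norm_num,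
            Real.sqrt_sq (by norm_num)]
        have h5 : 0 < Real.sqrt L := Real.sqrt_pos.2 hL
        have h6 : 0 < Real.sqrt (1 + δ) := Real.sqrt_pos.2 (by linarith)
        have h7 : Real.sqrt S * Real.sqrt S = S := Real.mul_self_sqrt hS0.le
        rw [Real.sqrt_div (by positivity), Real.sqrt_mul (by positivity) S, hSL, h4]
        field_simp
        nlinarith
      calc S = 2 / Real.sqrt (1 + δ) * Real.sqrt (S * L) *
          Real.sqrt ((1 + δ) * S / (4 * L)) := h3
        _ ≤ _ := by gcongr
    have h2 : T / 2 ≤ Real.sqrt (6 * ε) * Real.sqrt (S * L) := by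
      rw [← Real.sqrt_mul (by positivity), div_le_iff₀ two_pos, hT]
      apply Real.sqrt_le_iff.2 ⟨by positivity, ?_⟩
      rw [mul_pow, Real.sq_sqrt (by positivity)]
      have : (h : ℝ) * L * 24 * 2 ≤ ε * S * L * 24 := by
        have := mul_le_mul_of_nonneg_right hhS hL.le
        linarith
      linarith
    have h3 : 2 * (1 - ε) * Real.sqrt (S * L) ≤ τ * Real.sqrt (2 * (S - 2 * h)) := by
      rw [hτ, ← Real.sqrt_mul (by positivity)]
      apply Real.le_sqrt_of_sq_le
      rw [mul_pow, Real.sq_sqrt (by positivity)]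
      calc (2 * (1 - ε)) ^ 2 * (S * L) = 2 * (1 - ε) * L * (2 * (1 - ε) * S) := by ring
        _ ≤ _ := by gcongr
    calc S / σ + T / 2 ≤ (2 / Real.sqrt (1 + δ) + Real.sqrt (6 * ε)) * Real.sqrt (S * L) := by
          rw [add_mul]; exact add_le_add h1 h2
      _ ≤ 2 * (1 - ε) * Real.sqrt (S * L) := by gcongr
      _ ≤ _ := h3
  have hpos : 0 < S - 2 * h := by nlinarith [mul_pos hε1' hS0]
  have hmain := hW.measure_forall_swap_ge_le y hab (HA := HA) (HB := HB)
    (fun i hi => (Finset.mem_filter.1 (hHA hi)).2) (fun j hj => (Finset.mem_filter.1 (hHB hj)).2)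
    hHAc hHBc hσ (Real.sqrt_nonneg _) (Real.sqrt_nonneg _) hpos hthr
  refine le_trans (measure_mono ?_) (hmain.trans (ENNReal.ofReal_le_ofReal ?_))
  · intro ω hω i hi j hj
    exact hω i j (Finset.mem_filter.1 (hHA hi)).2 (Finset.mem_filter.1 (hHB hj)).2
  refine add_le_add le_rfl ?_
  have hexp : -T ^ 2 / (2 * (8 * h)) = -(3 * L) := by
    rw [hT, Real.sq_sqrt (by positivity)]
    field_simp
    norm_num
  have hpow : Real.exp (-(3 * L)) = ((n : ℝ) ^ 3)⁻¹ := by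
    rw [Real.exp_neg, show (3 : ℝ) * L = ((3 : ℕ) : ℝ) * L by norm_num, Real.exp_nat_mul, hLdef,
      Real.exp_log hn0]
  rw [hexp, hpow]
  calc (h : ℝ) ^ 2 * ((n : ℝ) ^ 3)⁻¹ ≤ (n : ℝ) ^ 2 * ((n : ℝ) ^ 3)⁻¹ := by gcongr
    _ = (n : ℝ)⁻¹ := by field_simp

/-- If the estimate has the partition of `y`, then `y` has the same objective value, so no swap can
improve on it. -/
lemma IsGaussianNoise.measure_samePartition_le (hW : IsGaussianNoise P W)
    (hn : 2 ≤ n) (y : Coloring n k) {a b : Fin k} (hab : a ≠ b) {c δ ε σ : ℝ} (hc : 0 < c)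
    (hδ : 0 < δ) (hε : 0 < ε) (hε1 : ε < 1) (ha : c * n ≤ (classSize y a : ℝ))
    (hb : c * n ≤ (classSize y b : ℝ)) (hfloor : 1 ≤ ⌊ε * c * n⌋₊)
    (hεδ : 2 / Real.sqrt (1 + δ) + Real.sqrt (6 * ε) ≤ 2 * (1 - ε))
    (hσ : (1 + δ) * ((classSize y a : ℝ) + classSize y b) / (4 * Real.log n) < σ ^ 2)
    (z : Ω → Coloring n k)
    (hz : ∀ ω i j, frobeniusNorm (observation y σ (W ω) - kMatrix (z ω)) ^ 2 ≤
        frobeniusNorm (observation y σ (W ω) - kMatrix (y ∘ Equiv.swap i j)) ^ 2) :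
    P {ω | SamePartition (z ω) y} ≤ ENNReal.ofReal (noSwapError c ε n) := by
  have hσ0 : σ ≠ 0 := by
    rintro rfl
    have hL : 0 < Real.log n := Real.log_pos (by exact_mod_cast hn)
    have : 0 ≤ (1 + δ) * ((classSize y a : ℝ) + classSize y b) / (4 * Real.log n) := by
      positivity
    rw [zero_pow two_ne_zero] at hσ
    linarith
  have hsub : {ω | SamePartition (z ω) y} ⊆
      {ω | ∀ i j, y i = a → y j = b → frobeniusNorm (observation y σ (W ω) - kMatrix y) ^ 2 ≤
        frobeniusNorm (observation y σ (W ω) - kMatrix (y ∘ Equiv.swap i j)) ^ 2} := by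
    intro ω hω i j _ _
    have := hz ω i j
    rwa [kMatrix_eq_iff.2 hω] at this
  refine (measure_mono hsub).trans ?_
  -- The noise is symmetric, so a negative `σ` reduces to `-σ` with noise `-W`.
  rcases lt_or_gt_of_ne hσ0 with hneg | hpos
  · have hobs : ∀ ω, observation y σ (W ω) = observation y (-σ) (-W ω) := by
      intro ω
      simp [observation]
    simp_rw [hobs]
    exact hW.neg.measure_forall_swap_ge_le_noSwapError hn y hab hc hδ hε hε1 ha hb hfloor hεδ
      (by linarith) (by rwa [neg_sq])
  · exact hW.measure_forall_swap_ge_le_noSwapError hn y hab hc hδ hε hε1 ha hb hfloor hεδ hpos hσ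

end LowerBound

/-- At `ε = 0` the inequality is strict because `2/√(1+δ) < 2`; continuity leaves room for a
positive `ε`. -/
lemma exists_swap_slack {δ : ℝ} (hδ : 0 < δ) :
    ∃ ε : ℝ, 0 < ε ∧ ε < 1 ∧ 2 / Real.sqrt (1 + δ) + Real.sqrt (6 * ε) ≤ 2 * (1 - ε) := by
  have h1 : 2 / Real.sqrt (1 + δ) < 2 := by
    rw [div_lt_iff₀ (Real.sqrt_pos.2 (by linarith))]
    have : 1 < Real.sqrt (1 + δ) := Real.lt_sqrt_of_sq_lt (by linarith)
    linarith
  have h2 : Tendsto (fun ε : ℝ => 2 * (1 - ε) - (2 / Real.sqrt (1 + δ) + Real.sqrt (6 * ε)))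
      (𝓝[>] 0) (𝓝 (2 * (1 - 0) - (2 / Real.sqrt (1 + δ) + Real.sqrt (6 * 0)))) := by
    refine Tendsto.mono_left (Continuous.tendsto ?_ 0) nhdsWithin_le_nhds
    fun_prop
  have h3 : (0 : ℝ) < 2 * (1 - 0) - (2 / Real.sqrt (1 + δ) + Real.sqrt (6 * 0)) := by
    simp only [sub_zero, mul_zero, Real.sqrt_zero]
    linarith
  obtain ⟨ε, hε, hε1, hε0⟩ := ((h2.eventually_const_lt h3).and
    ((eventually_nhdsWithin_of_eventually_nhds (gt_mem_nhds one_pos)).and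
      self_mem_nhdsWithin)).exists
  exact ⟨ε, hε0, hε1, by linarith⟩

/-- With `τ² = 2(1 - ε)L`, one has `n exp(-(τ+1)²/2) = exp(εL - τ - 1/2)`, which diverges because
`τ` is only of order `√L`. -/
lemma tendsto_noSwapError {c ε : ℝ} (hc : 0 < c) (hε : 0 < ε) (hε1 : ε < 1) :
    Tendsto (noSwapError c ε) atTop (𝓝 0) := by
  have hlog : Tendsto (fun n : ℕ => Real.log n) atTop atTop :=
    Real.tendsto_log_atTop.comp tendsto_natCast_atTop_atTop
  have hinv : Tendsto (fun n : ℕ => (n : ℝ)⁻¹) atTop (𝓝 0) := tendsto_inv_atTop_nhds_zero_nat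
  have hpi : 0 < Real.sqrt (2 * Real.pi) := Real.sqrt_pos.2 (by positivity)
  have hquad : Tendsto (fun L : ℝ => ε * L - Real.sqrt (2 * (1 - ε) * L) - 1 / 2) atTop atTop := by
    have h1 : Tendsto (fun L : ℝ => Real.sqrt L * (ε * Real.sqrt L - Real.sqrt (2 * (1 - ε))))
        atTop atTop := by
      refine Real.tendsto_sqrt_atTop.atTop_mul_atTop₀ ?_
      exact tendsto_atTop_add_const_right _ _ (Real.tendsto_sqrt_atTop.const_mul_atTop hε)
    refine (tendsto_atTop_add_const_right _ (-(1 / 2)) h1).congr' ?_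
    filter_upwards [eventually_ge_atTop 0] with L hL
    rw [Real.sqrt_mul (show 0 ≤ 2 * (1 - ε) by linarith) L]
    have := Real.mul_self_sqrt hL
    linear_combination ε * this
  have hexp : Tendsto (fun n : ℕ => ⌊ε * c * n⌋₊ *
      (Real.exp (-(Real.sqrt (2 * (1 - ε) * Real.log n) + 1) ^ 2 / 2) / Real.sqrt (2 * Real.pi)))
      atTop atTop := by
    have h2 := (Real.tendsto_exp_atTop.comp (hquad.comp hlog)).const_mul_atTop
      (show 0 < ε * c / 2 / Real.sqrt (2 * Real.pi) by positivity)
    refine tendsto_atTop_mono' _ ?_ h2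
    have hlarge := (tendsto_natCast_atTop_atTop (R := ℝ)).eventually_ge_atTop (2 / (ε * c))
    filter_upwards [hlarge, eventually_gt_atTop 1] with n hn hn1
    have hn1' : (1 : ℝ) < n := by exact_mod_cast hn1
    have hn0 : (0 : ℝ) < n := by linarith
    have hL : 0 ≤ Real.log n := Real.log_nonneg hn1'.le
    have hεc : 0 < ε * c := by positivity
    have h3 : 2 ≤ ε * c * n := by
      rw [div_le_iff₀ hεc] at hn
      linarith
    have h4 : ε * c / 2 * n ≤ ⌊ε * c * n⌋₊ := by
      have := Nat.lt_floor_add_one (ε * c * n)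
      linarith
    set s := Real.sqrt (2 * (1 - ε) * Real.log n) with hs
    have hss : s ^ 2 = 2 * (1 - ε) * Real.log n :=
      Real.sq_sqrt (mul_nonneg (by linarith) hL)
    have h5 : Real.exp (ε * Real.log n - s - 1 / 2) = n * Real.exp (-(s + 1) ^ 2 / 2) := by
      rw [show ε * Real.log n - s - 1 / 2 = Real.log n + -(s + 1) ^ 2 / 2 by
        linear_combination (1 / 2 : ℝ) * hss, Real.exp_add, Real.exp_log hn0]
    calc ε * c / 2 / Real.sqrt (2 * Real.pi) * Real.exp (ε * Real.log n - s - 1 / 2)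
        = ε * c / 2 * n * (Real.exp (-(s + 1) ^ 2 / 2) / Real.sqrt (2 * Real.pi)) := by
          rw [h5]; ring
      _ ≤ _ := by gcongr
  have h6 := ((Real.tendsto_exp_neg_atTop_nhds_zero.comp hexp).const_mul 2).add hinv
  rw [mul_zero, add_zero] at h6
  exact h6

/-! ### Passage to the limit for both estimators -/

lemma fixedSizes_swap_mem {n k : ℕ} {s : Fin k → ℕ} {y : Coloring n k} (hy : y ∈ fixedSizes n s)
    (i j : Fin n) : y ∘ Equiv.swap i j ∈ fixedSizes n s :=
  fun a => (classSize_comp_perm y _ a).trans (hy a)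

lemma minSize_swap_mem {n k : ℕ} {r : ℝ} {y : Coloring n k} (hy : y ∈ minSize n k r)
    (i j : Fin n) : y ∘ Equiv.swap i j ∈ minSize n k r := by
  intro a
  rw [classSize_comp_perm]
  exact hy a

/-- Subadditivity on `A` and its complement replaces the complement rule: the minimizers are
arbitrary choices, so the events need not be measurable. -/
lemma tendsto_one_of_compl_le {l : Filter ℕ} {Ω : ℕ → Type*} [∀ n, MeasurableSpace (Ω n)]
    (P : ∀ n, Measure (Ω n)) [∀ n, IsProbabilityMeasure (P n)] (A : ∀ n, Set (Ω n))
    {e : ℕ → ℝ} (he : Tendsto e l (𝓝 0))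
    (hA : ∀ᶠ n in l, P n (A n)ᶜ ≤ ENNReal.ofReal (e n)) :
    Tendsto (fun n => P n (A n)) l (𝓝 1) := by
  have h1 : Tendsto (fun n => 1 - ENNReal.ofReal (e n)) l (𝓝 1) := by
    have := ENNReal.Tendsto.sub (tendsto_const_nhds (x := (1 : ENNReal)))
      (ENNReal.tendsto_ofReal he) (Or.inl ENNReal.one_ne_top)
    simpa using this
  refine tendsto_of_tendsto_of_tendsto_of_le_of_le' h1 tendsto_const_nhds ?_
    (Eventually.of_forall fun n => prob_le_one)
  filter_upwards [hA] with n hn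
  rw [tsub_le_iff_right]
  calc (1 : ENNReal) = P n (A n ∪ (A n)ᶜ) := by rw [Set.union_compl_self, measure_univ]
    _ ≤ P n (A n) + P n (A n)ᶜ := measure_union_le _ _
    _ ≤ _ := by gcongr

lemma tendsto_zero_of_le {l : Filter ℕ} {Ω : ℕ → Type*} [∀ n, MeasurableSpace (Ω n)]
    (P : ∀ n, Measure (Ω n)) (A : ∀ n, Set (Ω n)) {e : ℕ → ℝ} (he : Tendsto e l (𝓝 0))
    (hA : ∀ᶠ n in l, P n (A n) ≤ ENNReal.ofReal (e n)) :
    Tendsto (fun n => P n (A n)) l (𝓝 0) := by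
  have h1 := ENNReal.tendsto_ofReal he
  rw [ENNReal.ofReal_zero] at h1
  exact tendsto_of_tendsto_of_tendsto_of_le_of_le' tendsto_const_nhds h1
    (Eventually.of_forall fun _ => bot_le) hA

lemma last_two_le_add {k : ℕ} (hk : 2 ≤ k) {s : Fin k → ℕ} (hs : Antitone s) {p q a b : Fin k}
    (hp : (p : ℕ) = k - 1) (hq : (q : ℕ) = k - 2) (hab : a ≠ b) : s p + s q ≤ s a + s b := by
  wlog hlt : a < b generalizing a b
  · rw [add_comm (s a)]
    exact this hab.symm (lt_of_le_of_ne (not_lt.1 hlt) hab.symm)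
  have h0 := Fin.lt_def.1 hlt
  have h1 : s p ≤ s b := hs (Fin.le_def.2 (by omega))
  have h2 : s q ≤ s a := hs (Fin.le_def.2 (by omega))
  omega

section MLE

variable {k : ℕ} {c : ℝ} {l : Filter ℕ} {s : ∀ _ : ℕ, Fin k → ℕ} {y : ∀ n : ℕ, Coloring n k}
  {σ : ℕ → ℝ} {Ω : ℕ → Type*} [∀ n, MeasurableSpace (Ω n)] {P : ∀ n, Measure (Ω n)}
  {W : ∀ n, Ω n → Matrix (Fin n) (Fin n) ℝ} {p q : Fin k}

lemma tendsto_recovery_one [∀ n, IsProbabilityMeasure (P n)] (hk : 2 ≤ k)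
    (hp : (p : ℕ) = k - 1) (hq : (q : ℕ) = k - 2)
    (hc : 0 < c) (hl : l ≤ atTop)
    (hs : ∀ᶠ n : ℕ in l, Antitone (s n))
    (hcs : ∀ᶠ n : ℕ in l, c * (n : ℝ) ≤ (s n p : ℝ))
    (hy : ∀ᶠ n : ℕ in l, y n ∈ fixedSizes n (s n)) (hW : ∀ n, IsGaussianNoise (P n) (W n))
    (Sp : ∀ n : ℕ, Set (Coloring n k)) (hSp : ∀ᶠ n : ℕ in l, y n ∈ Sp n)
    (z : ∀ n, Ω n → Coloring n k)
    (hz : ∀ᶠ n : ℕ in l, ∀ ω, IsMLE (Sp n) (observation (y n) (σ n) (W n ω)) (z n ω))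
    {δ : ℝ} (hδ : 0 < δ)
    (hσ : ∀ᶠ n : ℕ in l, σ n ^ 2 < (1 - δ) *
      ((s n p : ℝ) + (s n q : ℝ)) / (4 * Real.log n)) :
    Tendsto (fun n => P n {ω | SamePartition (z n ω) (y n)}) l (𝓝 1) := by
  have hk0 : (0 : ℝ) < k := by
    have : 0 < k := by omega
    exact_mod_cast this
  -- Shrinking `δ` only weakens the noise condition, and the finite bound requires `δ ≤ 1/2`.
  set δ' := min δ (1 / 2) with hδ'
  have hδ0 : 0 < δ' := lt_min hδ (by norm_num)
  -- The first bound makes the matching of colors a permutation; the second keeps the relabeled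
  -- errors below `δ'cn`.
  obtain ⟨γ, hγ0, hγ⟩ := exists_between
    (show 0 < min (c ^ 2 / k ^ 2) (δ' * c * c / k ^ 3) by positivity)
  refine tendsto_one_of_compl_le P _ ((tendsto_exactRecoveryError k hδ0 hγ0).mono_left hl) ?_
  filter_upwards [hs, hcs, hy, hSp, hz, hσ, hl (eventually_ge_atTop 2)]
    with n hs hcs hy hSp hz hσ hn
  have hcl : ∀ a, (classSize (y n) a : ℝ) = s n a := fun a => by rw [hy a]
  have hmin : ∀ a, c * n ≤ (classSize (y n) a : ℝ) := by
    intro a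
    rw [hcl]
    refine hcs.trans ?_
    have : s n p ≤ s n a := hs (Fin.le_def.2 (by omega))
    exact_mod_cast this
  have hL : 0 < Real.log n := Real.log_pos (by exact_mod_cast hn)
  have hne : p ≠ q := fun h => by
    have := congrArg Fin.val h
    omega
  refine (hW n).measure_not_samePartition_le hn (by omega) (y n) (z n)
    (S := (s n p : ℝ) + (s n q : ℝ)) (σ := σ n) hc hδ0 (min_le_right _ _)
    ?_ ?_ ?_ hmin ?_ hγ0 (hγ.trans_le (min_le_left _ _)) ?_ ?_
  · intro a b hab
    rw [hcl, hcl]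
    exact_mod_cast last_two_le_add hk hs hp hq hab
  · rw [← hcl, ← hcl]
    have := (card_filter_or_eq (y n) hne).symm.le.trans (Finset.card_le_univ _)
    rw [Fintype.card_fin] at this
    exact_mod_cast this
  · have h1 := hmin q
    rw [hcl] at h1
    linarith
  · refine hσ.le.trans ?_
    have : 1 - δ ≤ 1 - δ' := by linarith [min_le_left δ (1 / 2)]
    gcongr
  · have h1 := hγ.le.trans (min_le_right _ _)
    rw [le_div_iff₀ (by positivity)] at h1
    rwa [div_le_iff₀ hc]
  · exact fun ω => (hz ω).2 hSp

lemma tendsto_recovery_zero (hk : 2 ≤ k) (hp : (p : ℕ) = k - 1) (hq : (q : ℕ) = k - 2)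
    (hc : 0 < c) (hl : l ≤ atTop)
    (hs : ∀ᶠ n : ℕ in l, Antitone (s n))
    (hcs : ∀ᶠ n : ℕ in l, c * (n : ℝ) ≤ (s n p : ℝ))
    (hy : ∀ᶠ n : ℕ in l, y n ∈ fixedSizes n (s n)) (hW : ∀ n, IsGaussianNoise (P n) (W n))
    (Sp : ∀ n : ℕ, Set (Coloring n k))
    (hSp : ∀ᶠ n : ℕ in l, ∀ i j, y n ∘ Equiv.swap i j ∈ Sp n)
    (z : ∀ n, Ω n → Coloring n k)
    (hz : ∀ᶠ n : ℕ in l, ∀ ω, IsMLE (Sp n) (observation (y n) (σ n) (W n ω)) (z n ω))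
    {δ : ℝ} (hδ : 0 < δ)
    (hσ : ∀ᶠ n : ℕ in l, (1 + δ) *
      ((s n p : ℝ) + (s n q : ℝ)) / (4 * Real.log n) < σ n ^ 2) :
    Tendsto (fun n => P n {ω | SamePartition (z n ω) (y n)}) l (𝓝 0) := by
  obtain ⟨ε, hε, hε1, hεδ⟩ := exists_swap_slack hδ
  refine tendsto_zero_of_le P _ ((tendsto_noSwapError hc hε hε1).mono_left hl) ?_
  have hfloor : ∀ᶠ n : ℕ in atTop, 1 / (ε * c) ≤ (n : ℝ) :=
    tendsto_natCast_atTop_atTop.eventually_ge_atTop _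
  filter_upwards [hs, hcs, hy, hSp, hz, hσ, hl (eventually_ge_atTop 2), hl hfloor]
    with n hs hcs hy hSp hz hσ hn hfloor
  have hcl : ∀ a, (classSize (y n) a : ℝ) = s n a := fun a => by rw [hy a]
  have hne : p ≠ q := fun h => by
    have := congrArg Fin.val h
    omega
  refine (hW n).measure_samePartition_le (σ := σ n) hn (y n) hne hc hδ hε hε1 ?_ ?_ ?_ hεδ ?_ (z n)
    (fun ω i j => (hz ω).2 (hSp i j))
  · rwa [hcl]
  · rw [hcl]
    refine hcs.trans ?_
    have : s n p ≤ s n q :=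
      hs (Fin.le_def.2 (by omega))
    exact_mod_cast this
  · rw [Nat.one_le_floor_iff]
    rw [div_le_iff₀ (by positivity)] at hfloor
    linarith
  · rwa [hcl, hcl]

end MLE

end ColorRecovery

open ColorRecovery in
/-- The limit `n → ∞` is taken along a filter `l ≤ atTop`: `l = atTop` is the case where all large
`n` are considered, and smaller filters allow for `n` in a subsequence (such as the multiples of
`k`). The sizes `s n`, the true coloring `y n` and the noise level `σ n` may depend on `n`;
`k`, `c` and `δ` may not. The estimators are arbitrary choices of a minimizer. -/
theorem theorem2
    (k : ℕ) (hk : 2 ≤ k) (c : ℝ) (hc : 0 < c)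
    (l : Filter ℕ) (hl : l ≤ atTop)
    (s : ∀ _ : ℕ, Fin k → ℕ) (hs : ∀ᶠ n : ℕ in l, Antitone (s n))
    (hcs : ∀ᶠ n : ℕ in l, c * (n : ℝ) ≤ (s n ⟨k - 1, by omega⟩ : ℝ))
    (y : ∀ n : ℕ, Coloring n k) (hy : ∀ᶠ n : ℕ in l, y n ∈ fixedSizes n (s n))
    (σ : ℕ → ℝ)
    {Ω : ℕ → Type*} [∀ n, MeasurableSpace (Ω n)]
    (P : ∀ n, Measure (Ω n)) [∀ n, IsProbabilityMeasure (P n)]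
    (W : ∀ n, Ω n → Matrix (Fin n) (Fin n) ℝ) (hW : ∀ n, IsGaussianNoise (P n) (W n))
    (yTilde yBar : ∀ n, Ω n → Coloring n k)
    (hTilde : ∀ᶠ n : ℕ in l, ∀ ω,
      IsMLE (minSize n k (2 * c / 3)) (observation (y n) (σ n) (W n ω)) (yTilde n ω))
    (hBar : ∀ᶠ n : ℕ in l, ∀ ω,
      IsMLE (fixedSizes n (s n)) (observation (y n) (σ n) (W n ω)) (yBar n ω)) :
    ((∃ δ : ℝ, 0 < δ ∧ ∀ᶠ n : ℕ in l,
        σ n ^ 2 < (1 - δ) * ((s n ⟨k - 1, by omega⟩ : ℝ) + (s n ⟨k - 2, by omega⟩ : ℝ))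
          / (4 * Real.log n)) →
      Tendsto (fun n => P n {ω | SamePartition (yTilde n ω) (y n)}) l (𝓝 1) ∧
      Tendsto (fun n => P n {ω | SamePartition (yBar n ω) (y n)}) l (𝓝 1)) ∧
    ((∃ δ : ℝ, 0 < δ ∧ ∀ᶠ n : ℕ in l,
        (1 + δ) * ((s n ⟨k - 1, by omega⟩ : ℝ) + (s n ⟨k - 2, by omega⟩ : ℝ))
          / (4 * Real.log n) < σ n ^ 2) →
      Tendsto (fun n => P n {ω | SamePartition (yTilde n ω) (y n)}) l (𝓝 0) ∧
      Tendsto (fun n => P n {ω | SamePartition (yBar n ω) (y n)}) l (𝓝 0)) := by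
  -- The truth is feasible for `yTilde` because `2c/3 ≤ c`.
  have hfix : ∀ᶠ n : ℕ in l, y n ∈ minSize n k (2 * c / 3) := by
    filter_upwards [hs, hcs, hy] with n hs hcs hy j
    rw [hy j]
    have h1 : (s n ⟨k - 1, by omega⟩ : ℝ) ≤ s n j := by
      exact_mod_cast hs (Fin.le_def.2 (by simp only; omega))
    have h2 : 0 ≤ c * n := by positivity
    linarith
  have hfix' : ∀ᶠ n : ℕ in l, ∀ i j, y n ∘ Equiv.swap i j ∈ minSize n k (2 * c / 3) := by
    filter_upwards [hfix] with n hn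
    exact minSize_swap_mem hn
  have hy' : ∀ᶠ n : ℕ in l, ∀ i j, y n ∘ Equiv.swap i j ∈ fixedSizes n (s n) := by
    filter_upwards [hy] with n hn
    exact fixedSizes_swap_mem hn
  refine ⟨?_, ?_⟩
  · rintro ⟨δ, hδ, hσ⟩
    exact ⟨tendsto_recovery_one hk rfl rfl hc hl hs hcs hy hW _ hfix yTilde hTilde hδ hσ,
      tendsto_recovery_one hk rfl rfl hc hl hs hcs hy hW _ hy yBar hBar hδ hσ⟩
  · rintro ⟨δ, hδ, hσ⟩
    exact ⟨tendsto_recovery_zero hk rfl rfl hc hl hs hcs hy hW _ hfix' yTilde hTilde hδ hσ,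
      tendsto_recovery_zero hk rfl rfl hc hl hs hcs hy hW _ hy' yBar hBar hδ hσ⟩
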